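/- Let $\mathbf k$ be a field and let $\underline{\mathcal M}$ be any matroid (orientable or not) on the ground set $\{1,\dots,n\}$, with lattice of flats $L$. Put $S=\mathbf k[x_1,\dots,x_n]$, and for a flat $F$ put $m_x(F)=\prod_{i\notin F}x_i$. The matroid ideal is $M=\langle m_x(F) : F\in L \text{ a proper flat}\rangle\subset S$. Let $P$ be the order dual of $L$ (flats ordered by reverse inclusion), with least element $\hat 0=\{1,\dots,n\}$ and rank function $\mathrm{rk}$ (the rank of $F$ in $P$ is the corank of the flat $F$). Label each atom of $P$, that is, each hyperplane $H$ of the matroid, by $m_H=m_x(H)$, and for $F\in P$ let $m_F=\mathrm{lcm}\{m_H : H \text{ an atom of } P,\ H\le F\}$, so that $m_{\hat 0}=1$. For $F\in P$ let $\Delta(F)$ be the order complex of the open interval $(\hat 0,F)$ of $P$, whose $i$-simplices are the chains $[F_0,\dots,F_i]$ with $F>F_0>\dots>F_i>\hat 0$. Let $C_i(\Delta(F))$, $i\ge -1$, be its augmented chain complex over $\mathbf k$, with differential $\partial_i[F_0,\dots,F_i]=\sum_{j}(-1)^j[F_0,\dots,\widehat{F_j},\dots,F_i]$, where $\partial_0[F_0]=\emptyset$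 and $\partial_{-1}=0$. Let $Z_i(\Delta(F))=\ker\partial_i$, and set $Z_{-2}(\Delta(\hat 0))=\mathbf k$. If $F$ covers $F'$ in $P$ and $\mathrm{rk}\,F=i+1$, let $\phi: Z_{i-1}(\Delta(F))\to Z_{i-2}(\Delta(F'))$ be the restriction to cycles of the linear map which, for $i\ge 1$, sends $[F_0,F_1,\dots,F_{i-1}]$ to $[F_1,\dots,F_{i-1}]$ if $F_0=F'$ and to $0$ otherwise; for $i=0$ it is the map $\mathbf k\,\emptyset=Z_{-1}(\Delta(F))\to\mathbf k$, $\emptyset\mapsto 1$. Define $$\mathcal C(P)_i=\bigoplus_{F\in P,\ \mathrm{rk}(F)=i} Z_{i-2}(\Delta(F))\otimes_{\mathbf k}\langle m_F\rangle ,\qquad i\ge 0,$$ with differential $\partial$ having components $\phi\otimes(\langle m_F\rangle\hookrightarrow\langle m_{F'}\rangle)$ for $F$ covering $F'$. It carries the $\mathbb N^n$-grading induced from the ideals $\langle m_F\rangle\subset S$; in particular $\mathcal C(P)_0=\mathbf k\otimes_{\mathbf k}\langle 1\rangle=S$. **Theorem.** $(\mathcal C(P),\partial)$ is a minimal $\mathbb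 N^n$-graded free $S$-resolution of the matroid ideal $M$. That is: each $\mathcal C(P)_i$ is an $\mathbb N^n$-graded free $S$-module of finite rank with a homogeneous basis; the differentials are $S$-linear and homogeneous of degree $0$; the sequence $\cdots\to\mathcal C(P)_2\to\mathcal C(P)_1\to\mathcal C(P)_0=S\to S/M\to 0$ is exact (equivalently, $\cdots\to\mathcal C(P)_2\to\mathcal C(P)_1\to M\to 0$ is exact); and $\partial(\mathcal C(P)_{i+1})\subseteq\langle x_1,\dots,x_n\rangle\,\mathcal C(P)_i$ for all $i\ge 0$. -/

import Mathlib

open scoped TensorProduct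

noncomputable section

namespace PosetResolution

/-! ### Order complexes of open lower intervals and the complex of cycle spaces -/

section Poset

variable {P : Type*} [PartialOrder P] [OrderBot P]

/-- The simplices with `j` vertices (hence of dimension `j - 1`) of the order complex `Δ(F)` of
the lower interval `[⊥, F]`: decreasing chains `F > F₀ > F₁ > ⋯ > F_{j-1} > ⊥`.
For `j = 0` there is exactly one, the empty simplex. -/
def Simplex (F : P) (j : ℕ) : Type _ :=
  {s : Fin j → P // StrictAnti s ∧ ∀ a, ⊥ < s a ∧ s a < F}

namespace Simplex

variable {F F' : P} {j : ℕ}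

/-- The face of a simplex obtained by omitting its `a`-th vertex. -/
def face (s : Simplex F (j + 1)) (a : Fin (j + 1)) : Simplex F j :=
  ⟨s.1 ∘ a.succAbove, s.2.1.comp_strictMono (Fin.strictMono_succAbove a), fun _ => s.2.2 _⟩

/-- If `F₀ = F'`, the simplex `[F₁, …, F_j]` of `Δ(F')` obtained from `[F₀, F₁, …, F_j]`. -/
def tail (s : Simplex F (j + 1)) (h : s.1 0 = F') : Simplex F' j :=
  ⟨fun a => s.1 a.succ, s.2.1.comp_strictMono (Fin.strictMono_succ), fun a =>
    ⟨(s.2.2 _).1, h ▸ s.2.1 (Fin.succ_pos a)⟩⟩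

/-- The empty simplex. -/
def empty (F : P) : Simplex F 0 :=
  ⟨Fin.elim0, fun a => a.elim0, fun a => a.elim0⟩

instance : Unique (Simplex F 0) where
  default := empty F
  uniq _ := Subtype.ext (funext fun a => a.elim0)

end Simplex

variable (k : Type*) [Field k]

/-- The space `C_{j-1}(Δ(F))` of chains: formal linear combinations of simplices with `j`
vertices. -/
abbrev Chains (F : P) (j : ℕ) : Type _ := Simplex F j →₀ k

/-- The differential of the augmented chain complex,
`∂[F₀, …, F_j] = ∑ₐ (-1)ᵃ [F₀, …, F̂ₐ, …, F_j]` (so `∂[F₀] = ∅`). -/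
def boundary (F : P) (j : ℕ) : Chains k F (j + 1) →ₗ[k] Chains k F j :=
  Finsupp.linearCombination k
    (fun s => ∑ a : Fin (j + 1), Finsupp.single (s.face a) ((-1 : k) ^ (a : ℕ)))

/-- The cycle space `Z_{j-1}(Δ(F))`; in dimension `-1` the differential is zero. -/
def cycles (F : P) : (j : ℕ) → Submodule k (Chains k F j)
  | 0 => ⊤
  | j + 1 => LinearMap.ker (boundary k F j)

open Classical in
/-- `phi k F F' (j + 1)` is the map `C_j(Δ(F)) → C_{j-1}(Δ(F'))` which sends `[F₀, F₁, …, F_j]` to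
`[F₁, …, F_j]` if `F₀ = F'` and to `0` otherwise. The value `phi k F F' 0`, which sends the empty
simplex to the empty simplex, is used (only) for the last map
`⨁_{rk F = 1} Z_{-1}(Δ(F)) ⟶ k`. -/
def phi (F F' : P) : (j : ℕ) → Chains k F j →ₗ[k] Chains k F' (j - 1)
  | 0 => Finsupp.linearCombination k (fun _ => Finsupp.single (Simplex.empty F') 1)
  | _ + 1 => Finsupp.linearCombination k
      (fun s => if h : s.1 0 = F' then Finsupp.single (s.tail h) 1 else 0)

theorem boundary_phi {F F' : P} (h : F' ⋖ F) (j : ℕ) (z : Chains k F (j + 2)) :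
    boundary k F' j (phi k F F' (j + 2) z) = - phi k F F' (j + 1) (boundary k F (j + 1) z) := by
  classical
  induction z using Finsupp.induction_linear with
  | zero => simp
  | add f g hf hg => rw [map_add, map_add, hf, hg, map_add, map_add, neg_add]
  | single s c =>
    have key : ∀ t : Simplex F (j + 2),
        boundary k F' j (phi k F F' (j + 2) (Finsupp.single t 1)) =
          - phi k F F' (j + 1) (boundary k F (j + 1) (Finsupp.single t 1)) := by
      intro t
      have h0 : ¬ (t.face 0).1 0 = F' := by
        intro e
        have e1 : t.1 1 = F' := e
        have l1 : t.1 1 < t.1 0 := t.2.1 (by simp)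
        exact h.2 (e1 ▸ l1) (t.2.2 0).2
      have hs : ∀ a : Fin (j + 1), (t.face a.succ).1 0 = t.1 0 := by
        intro a
        simp [Simplex.face]
      by_cases ht : t.1 0 = F'
      · simp only [phi, boundary, Finsupp.linearCombination_single, one_smul, dif_pos ht, map_sum]
        rw [Fin.sum_univ_succ (n := j + 1), dif_neg h0, smul_zero, zero_add,
          ← Finset.sum_neg_distrib]
        refine Finset.sum_congr rfl fun a _ => ?_
        rw [dif_pos ((hs a).trans ht)]
        have : (t.tail ht).face a = (t.face a.succ).tail ((hs a).trans ht) := by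
          apply Subtype.ext
          funext b
          simp [Simplex.face, Simplex.tail]
        rw [this]
        simp [pow_succ]
      · simp only [phi, boundary, Finsupp.linearCombination_single, one_smul, dif_neg ht, map_sum,
          map_zero]
        rw [Fin.sum_univ_succ (n := j + 1), dif_neg h0, smul_zero, zero_add, eq_comm, neg_eq_zero]
        refine Finset.sum_eq_zero fun a _ => ?_
        rw [dif_neg (by rw [hs a]; exact ht), smul_zero]
    have e : (Finsupp.single s c : Chains k F (j + 2)) = c • Finsupp.single s 1 := by simp
    rw [e]
    simp only [map_smul, key, smul_neg]

theorem phi_mem_cycles {F F' : P} (h : F' ⋖ F) :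
    ∀ (j : ℕ) (z : Chains k F j), z ∈ cycles k F j → phi k F F' j z ∈ cycles k F' (j - 1)
  | 0, _, _ => Submodule.mem_top
  | 1, _, _ => Submodule.mem_top
  | j + 2, z, hz => by
    have hz' : boundary k F (j + 1) z = 0 := hz
    change boundary k F' j (phi k F F' (j + 2) z) = 0
    rw [boundary_phi k h, hz', map_zero, neg_zero]

/-- For `F` of rank `i`, the space `Z_{i-2}(Δ(F))` of top-dimensional cycles, that is, of cycles
supported on simplices with `i - 1` vertices. For `i = 0` (so `F = ⊥`) this is the line `k`
spanned by the empty simplex, which is the last term of the complex of cycle spaces. -/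
abbrev TopCycles (F : P) (i : ℕ) : Submodule k (Chains k F (i - 1)) := cycles k F (i - 1)

/-- The map `φ : Z_{i-1}(Δ(F)) → Z_{i-2}(Δ(F'))` for `F` of rank `i + 1` covering `F'`. -/
def phiTop {F F' : P} (h : F' ⋖ F) (i : ℕ) : TopCycles k F (i + 1) →ₗ[k] TopCycles k F' i :=
  (phi k F F' i).restrict (phi_mem_cycles k h i)

end Poset

/-! ### Labelled posets and the complex `𝒞(P)` -/

section Labelled

variable {P : Type*} [PartialOrder P] [OrderBot P] [Finite P]
variable {σ : Type*}

/-- The elements of rank `i` of a graded poset with least element. -/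
def Level (P : Type*) [PartialOrder P] [OrderBot P] (i : ℕ) : Type _ :=
  {F : P // Order.height F = (i : ℕ∞)}

instance (i : ℕ) : Fintype (Level P i) :=
  haveI : Finite (Level P i) := inferInstanceAs (Finite {F : P // Order.height F = (i : ℕ∞)})
  Fintype.ofFinite _

open Classical in
/-- The exponent vector of `m_F = lcm {m_A : A an atom, A ≤ F}`, where `ℓ A` is the exponent vector
of the label `m_A` of the atom `A`. In particular `m_⊥ = 1`. -/
def deg (ℓ : P → σ →₀ ℕ) (F : P) : σ →₀ ℕ :=
  letI := Fintype.ofFinite P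
  (Finset.univ.filter fun A : P => IsAtom A ∧ A ≤ F).sup ℓ

theorem deg_mono (ℓ : P → σ →₀ ℕ) {F' F : P} (h : F' ≤ F) : deg ℓ F' ≤ deg ℓ F := by
  classical
  let := Fintype.ofFinite P
  refine Finset.sup_mono fun A hA => ?_
  simp only [Finset.mem_filter, Finset.mem_univ, true_and] at hA ⊢
  exact ⟨hA.1, hA.2.trans h⟩

variable (k : Type*) [Field k]

/-- The principal ideal `⟨m_F⟩` of the polynomial ring. -/
def labelIdeal (ℓ : P → σ →₀ ℕ) (F : P) : Ideal (MvPolynomial σ k) :=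
  Ideal.span {MvPolynomial.monomial (deg ℓ F) 1}

theorem labelIdeal_anti (ℓ : P → σ →₀ ℕ) {F' F : P} (h : F' ≤ F) :
    labelIdeal k ℓ F ≤ labelIdeal k ℓ F' := by
  rw [labelIdeal, labelIdeal, Ideal.span_singleton_le_span_singleton]
  exact (MvPolynomial.monomial_dvd_monomial).2 ⟨Or.inr (deg_mono ℓ h), one_dvd _⟩

/-- The summand `Z_{i-2}(Δ(F)) ⊗ ⟨m_F⟩` of `𝒞(P)` for `F` of rank `i` (the ideal is written on the
left since the polynomial ring acts on that factor). -/
abbrev Summand (ℓ : P → σ →₀ ℕ) (F : P) (i : ℕ) : Type _ :=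
  labelIdeal k ℓ F ⊗[k] TopCycles k F i

/-- The term of homological degree `i` of `𝒞(P)`:
the direct sum of `Z_{i-2}(Δ(F)) ⊗ ⟨m_F⟩` over the finitely many `F` of rank `i`. -/
abbrev Term (ℓ : P → σ →₀ ℕ) (i : ℕ) : Type _ :=
  (F : Level P i) → Summand k ℓ F.1 i

open Classical in
/-- The component of the differential `φ ⊗ inclusion` from the summand of `F` to that of `F'`; it is
zero unless `F` covers `F'`. -/
def diffComponent (ℓ : P → σ →₀ ℕ) (F F' : P) (i : ℕ) :
    Summand k ℓ F (i + 1) →ₗ[MvPolynomial σ k] Summand k ℓ F' i :=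
  if h : F' ⋖ F then
    TensorProduct.AlgebraTensorModule.map (Submodule.inclusion (labelIdeal_anti k ℓ h.le))
      (phiTop k h i)
  else 0

/-- The differential `∂ = φ ⊗ inclusion` of `𝒞(P)`. -/
def diff (ℓ : P → σ →₀ ℕ) (i : ℕ) :
    Term k ℓ (i + 1) →ₗ[MvPolynomial σ k] Term k ℓ i :=
  LinearMap.pi fun F' => ∑ F : Level P (i + 1),
    (diffComponent k ℓ F.1 F'.1 i).comp (LinearMap.proj F)

/-- The canonical map from the last term `⟨m_⊥⟩ ⊗ k` of `𝒞(P)` to the polynomial ring, sending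
`p ⊗ c ∅` to `c p`. -/
def augmentation (ℓ : P → σ →₀ ℕ) : Term k ℓ 0 →ₗ[MvPolynomial σ k] MvPolynomial σ k :=
  ∑ F : Level P 0,
    ((TensorProduct.AlgebraTensorModule.rid k (MvPolynomial σ k) (MvPolynomial σ k)).toLinearMap.comp
      (TensorProduct.AlgebraTensorModule.map (Submodule.subtype (labelIdeal k ℓ F.1))
        ((Finsupp.linearCombination k (fun _ => (1 : k))).comp
          (Submodule.subtype (TopCycles k F.1 0))))).comp (LinearMap.proj F)

/-- The component of multidegree `a` of `𝒞(P)` in homological degree `i`: in each summand it is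
spanned by the `p ⊗ z` with `p ∈ ⟨m_F⟩` a scalar multiple of the monomial `x^a`. -/
def gradedPiece (ℓ : P → σ →₀ ℕ) (i : ℕ) (a : σ →₀ ℕ) : Submodule k (Term k ℓ i) :=
  Submodule.pi Set.univ fun F : Level P i =>
    Submodule.span k {t : Summand k ℓ F.1 i | ∃ (p : labelIdeal k ℓ F.1) (z : TopCycles k F.1 i),
      (∃ c : k, (p : MvPolynomial σ k) = MvPolynomial.monomial a c) ∧ t = p ⊗ₜ[k] z}

end Labelled

/-! ### Minimal multigraded free resolutions -/

open Classical in
/-- Let `⋯ → C 2 → C 1 → C 0` be modules and linear maps over `S = k[x_s : s ∈ σ]`, with a map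
`ε : C 0 → S` and `k`-subspaces `𝒞 i a` of `C i` (the components of multidegree `a`). This says that
these form a minimal `ℕ^σ`-graded free resolution of the ideal `I`, in the usual form
`⋯ → C 2 → C 1 → S → S / I → 0`, where `C 0` is identified with `S` through `ε`.
Equivalently `⋯ → C 2 → C 1 → I → 0` is exact, the map `C 1 → I` being `ε ∘ d 0`. -/
structure IsMinimalGradedFreeResolution {σ k : Type*} [Field k] (I : Ideal (MvPolynomial σ k))
    (C : ℕ → Type*) [∀ i, AddCommGroup (C i)] [∀ i, Module (MvPolynomial σ k) (C i)]
    [∀ i, Module k (C i)] [∀ i, IsScalarTower k (MvPolynomial σ k) (C i)]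
    (d : ∀ i, C (i + 1) →ₗ[MvPolynomial σ k] C i)
    (ε : C 0 →ₗ[MvPolynomial σ k] MvPolynomial σ k)
    (𝒞 : ∀ i, (σ →₀ ℕ) → Submodule k (C i)) : Prop where
  /-- Each term is the direct sum of its components. -/
  isInternal : ∀ i, DirectSum.IsInternal (𝒞 i)
  /-- Multiplication is compatible with the multidegrees. -/
  smul_mem : ∀ i a b (c : k), ∀ x ∈ 𝒞 i a, MvPolynomial.monomial b c • x ∈ 𝒞 i (b + a)
  /-- Each term is graded free of finite rank: it has a finite basis of homogeneous elements. -/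
  free : ∀ i, ∃ (r : ℕ) (e : Module.Basis (Fin r) (MvPolynomial σ k) (C i)) (δ : Fin r → σ →₀ ℕ),
    ∀ q, e q ∈ 𝒞 i (δ q)
  /-- The differentials are homogeneous of degree zero. -/
  d_mem : ∀ i a, ∀ x ∈ 𝒞 (i + 1) a, d i x ∈ 𝒞 i a
  /-- The augmentation is homogeneous of degree zero. -/
  ε_mem : ∀ a, ∀ x ∈ 𝒞 0 a, ∃ c : k, ε x = MvPolynomial.monomial a c
  /-- The sequence is a complex and is exact in all positive homological degrees. -/
  exact : ∀ i, Function.Exact (d (i + 1)) (d i)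
  /-- The term in homological degree zero is the polynomial ring. -/
  bijective : Function.Bijective ε
  /-- The image of `C 1` in the polynomial ring is the ideal `I`. -/
  range_eq : LinearMap.range (ε.comp (d 0)) = I
  /-- Minimality: every differential has image in `𝔪 C`, where `𝔪` is generated by the
  variables. -/
  minimal : ∀ i, LinearMap.range (d i) ≤
    Ideal.span (Set.range (MvPolynomial.X : σ → MvPolynomial σ k)) •
      (⊤ : Submodule (MvPolynomial σ k) (C i))

end PosetResolution

/-! ### Matroids -/

namespace MatroidIdeal

variable {σ : Type*}

/-- The lattice of flats of a matroid, ordered by inclusion. -/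
abbrev Flats (M : Matroid σ) : Type _ := {F : Set σ // M.IsFlat F}

instance (M : Matroid σ) : OrderTop (Flats M) where
  top := ⟨M.E, M.ground_isFlat⟩
  le_top F := F.2.subset_ground

open Classical in
/-- The exponent vector of the squarefree monomial `m_x(F) = ∏_{i ∉ F} x_i`. -/
def complExponent [Fintype σ] (F : Set σ) : σ →₀ ℕ :=
  Finsupp.equivFunOnFinite.symm fun i => if i ∈ F then 0 else 1

/-- The matroid ideal: it is generated by the monomials `m_x(F)` of the proper flats `F`. -/
def matroidIdeal [Fintype σ] (k : Type*) [Field k] (M : Matroid σ) : Ideal (MvPolynomial σ k) :=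
  Ideal.span {p | ∃ F : Set σ, M.IsFlat F ∧ F ≠ M.E ∧ p = MvPolynomial.monomial (complExponent F) 1}

/-- The labelling of the order dual `P` of the lattice of flats: the label of an atom of `P`, that
is, of a hyperplane `H` of the matroid, is `m_x(H)`. (Only the labels of atoms are used.) -/
def flatLabel [Fintype σ] (M : Matroid σ) (F : (Flats M)ᵒᵈ) : σ →₀ ℕ :=
  complExponent (OrderDual.ofDual F).1

end MatroidIdeal

end

/-! Fix a multidegree `a`. In the strand of `𝒞(P)` of multidegree `a` the summand of `F` contributes
its cycle space if `m_F ∣ x^a` and `0` otherwise. Every flat is an intersection of hyperplanes, so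
`m_F = m_x(F)`, and `m_x(F) ∣ x^a` says that `F` contains the zero set of `a`, that is, `F ≤ G` in
`P` for `G` the closure of that zero set. Exactness thus reduces to that of the complex of cycle
spaces of each interval `[⊥, G]` (`exists_cycles_lift`).

For `G ≠ ⊥` this follows from the fact that the part of `(⊥, G]` of rank at most `r` has no reduced
homology below dimension `r - 1` (`acyclic_truncation`). Let cycles `y_F`, with `F` of rank `i + 1`,
be killed by the differential. Then `W = ∑ [F] ∧ y_F` has boundary `∑ y_F = 0`, so `W = ∂U` with `U`
a chain of simplices with `i + 2` vertices in ranks at most `i + 2`. Such simplices meet every rank,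
so `U = ∑ [F] ∧ u_F` over `F` of rank `i + 2`. In `∂U = ∑ u_F - ∑ [F] ∧ ∂u_F = W`, the terms
involving rank `i + 2` give `∂u_F = 0`, and the others give `∑ u_F = W`: the `u_F` are cycles
lifting `y`. Chains live in an exterior algebra, where the boundary is an antiderivation and
orientation signs are automatic.

Acyclicity is proved by adding or deleting one vertex at a time and controlling its link
(`Acyclic.insert_of_link`, `Acyclic.of_insert`). For an open interval (`acyclic_Ioo`) one starts
from the cone formed by the flats containing a suitable element `p`. The matroid enters through the
closure exchange property: joining a flat with an element outside it gives a cover.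

Freeness holds because each `⟨m_F⟩` is principal, and minimality because distinct flats have
distinct labels. -/

noncomputable section

namespace PosetResolution

/-! ### Chains of a poset in the exterior algebra -/

section Exterior

variable (k : Type*) [Field k] {V : Type*}

/-- The generator of the exterior algebra on the vertex set `V` given by the vertex `v`. -/
def vertex (v : V) : ExteriorAlgebra k (V →₀ k) :=
  ExteriorAlgebra.ι k (Finsupp.single v 1)

/-- The wedge product of a list of vertices. -/
def wedge (l : List V) : ExteriorAlgebra k (V →₀ k) := (l.map (vertex k)).prod

/-- The boundary operator: contraction with the sum of all coordinates. -/
def extBoundary : ExteriorAlgebra k (V →₀ k) →ₗ[k] ExteriorAlgebra k (V →₀ k) :=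
  CliffordAlgebra.contractLeft (Q := 0) (Finsupp.linearCombination k fun _ => (1 : k))

/-- Contraction with the coordinate of the vertex `x`. -/
def contractVertex (x : V) : ExteriorAlgebra k (V →₀ k) →ₗ[k] ExteriorAlgebra k (V →₀ k) :=
  CliffordAlgebra.contractLeft (Q := 0) (Finsupp.lapply x)

@[simp] theorem wedge_nil : wedge k ([] : List V) = 1 := rfl

@[simp] theorem wedge_cons (v : V) (l : List V) : wedge k (v :: l) = vertex k v * wedge k l := by
  simp [wedge]

/-- Contraction is an antiderivation and the functional takes the value 1 on every vertex. On
cycles, left multiplication by a vertex is therefore a right inverse of the boundary, which is the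
usual cone construction. -/
theorem extBoundary_vertex_mul (v : V) (w : ExteriorAlgebra k (V →₀ k)) :
    extBoundary k (vertex k v * w) = w - vertex k v * extBoundary k w := by
  refine (CliffordAlgebra.contractLeft_ι_mul _ _ _).trans ?_
  rw [Finsupp.linearCombination_single, smul_eq_mul, mul_one, one_smul]
  rfl

@[simp] theorem extBoundary_one : extBoundary k (1 : ExteriorAlgebra k (V →₀ k)) = 0 :=
  CliffordAlgebra.contractLeft_one _ _

@[simp] theorem contractVertex_one (x : V) :
    contractVertex k x (1 : ExteriorAlgebra k (V →₀ k)) = 0 :=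
  CliffordAlgebra.contractLeft_one _ _

theorem contractVertex_self_mul (x : V) (w : ExteriorAlgebra k (V →₀ k)) :
    contractVertex k x (vertex k x * w) = w - vertex k x * contractVertex k x w := by
  refine (CliffordAlgebra.contractLeft_ι_mul _ _ _).trans ?_
  rw [Finsupp.lapply_apply, Finsupp.single_eq_same, one_smul]
  rfl

theorem contractVertex_mul {x v : V} (h : v ≠ x) (w : ExteriorAlgebra k (V →₀ k)) :
    contractVertex k x (vertex k v * w) = - (vertex k v * contractVertex k x w) := by
  refine (CliffordAlgebra.contractLeft_ι_mul _ _ _).trans ?_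
  rw [Finsupp.lapply_apply, Finsupp.single_eq_of_ne (Ne.symm h), zero_smul, zero_sub]
  rfl

theorem vertex_mul_self (v : V) : vertex k v * vertex k v = 0 :=
  ExteriorAlgebra.ι_sq_zero _

theorem vertex_mul_swap (v w : V) : vertex k v * vertex k w = - (vertex k w * vertex k v) :=
  eq_neg_of_add_eq_zero_left (ExteriorAlgebra.ι_add_mul_swap _ _)

theorem wedge_perm {l l' : List V} (h : l.Perm l') :
    wedge k l = wedge k l' ∨ wedge k l = - wedge k l' := by
  induction h with
  | nil => exact Or.inl rfl
  | cons v _ ih =>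
    rcases ih with ih | ih
    · left; simp [ih]
    · right; simp [ih]
  | swap v w l =>
    right
    simp only [wedge_cons]
    rw [← mul_assoc, ← mul_assoc, vertex_mul_swap k w v, neg_mul]
  | trans _ _ ih₁ ih₂ =>
    rcases ih₁ with h1 | h1 <;> rcases ih₂ with h2 | h2 <;> simp [h1, h2]

variable [PartialOrder V]

/-- Lists of pairwise comparable, distinct elements of `X`, with `j` members. -/
def IsChainList (X : Set V) (j : ℕ) (l : List V) : Prop :=
  l.length = j ∧ l.Pairwise (fun a b => a < b ∨ b < a) ∧ ∀ v ∈ l, v ∈ X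

/-- The space of oriented simplicial chains with `j` vertices of the order complex of the
subset `X`, inside the exterior algebra. -/
def chainSpan (X : Set V) (j : ℕ) : Submodule k (ExteriorAlgebra k (V →₀ k)) :=
  Submodule.span k (wedge k '' {l | IsChainList X j l})

variable {k} {X Y : Set V} {j m : ℕ} {x : V}

theorem wedge_mem_chainSpan {l : List V} (h : IsChainList X j l) : wedge k l ∈ chainSpan k X j :=
  Submodule.subset_span ⟨l, h, rfl⟩

theorem chainSpan_mono (h : X ⊆ Y) (j : ℕ) : chainSpan k X j ≤ chainSpan k Y j :=
  Submodule.span_mono (Set.image_mono fun _ hl => ⟨hl.1, hl.2.1, fun v hv => h (hl.2.2 v hv)⟩)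

/-- To prove that a linear map sends chains into a submodule, check it on wedges. -/
theorem map_mem_of_mem_chainSpan {M : Type*} [AddCommGroup M] [Module k M]
    (f : ExteriorAlgebra k (V →₀ k) →ₗ[k] M) (N : Submodule k M)
    (h : ∀ l, IsChainList X j l → f (wedge k l) ∈ N) {w : ExteriorAlgebra k (V →₀ k)}
    (hw : w ∈ chainSpan k X j) : f w ∈ N := by
  have : chainSpan k X j ≤ N.comap f := by
    refine Submodule.span_le.2 ?_
    rintro _ ⟨l, hl, rfl⟩
    exact h l hl
  exact this hw

theorem IsChainList.cons {l : List V} (hl : IsChainList Y j l) (hYX : Y ⊆ X) (hx : x ∈ X)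
    (hc : ∀ y ∈ Y, y < x ∨ x < y) : IsChainList X (j + 1) (x :: l) := by
  refine ⟨by simp [hl.1], List.pairwise_cons.2 ⟨fun y hy => (hc y (hl.2.2 y hy)).symm, hl.2.1⟩, ?_⟩
  intro v hv
  rcases List.mem_cons.1 hv with rfl | hv
  · exact hx
  · exact hYX (hl.2.2 v hv)

theorem vertex_mul_mem_chainSpan (hYX : Y ⊆ X) (hx : x ∈ X) (hc : ∀ y ∈ Y, y < x ∨ x < y)
    {w : ExteriorAlgebra k (V →₀ k)} (hw : w ∈ chainSpan k Y j) :
    vertex k x * w ∈ chainSpan k X (j + 1) := by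
  refine map_mem_of_mem_chainSpan (LinearMap.mulLeft k (vertex k x)) _ (fun l hl => ?_) hw
  rw [LinearMap.mulLeft_apply, ← wedge_cons]
  exact wedge_mem_chainSpan (hl.cons hYX hx hc)

theorem extBoundary_wedge_mem (l : List V) (hl : l.Pairwise (fun a b => a < b ∨ b < a)) :
    ∀ j, l.length = j + 1 → extBoundary k (wedge k l) ∈ chainSpan k {v | v ∈ l} j := by
  induction l with
  | nil => intro j h; simp at h
  | cons v l ih =>
    intro j h
    rw [List.pairwise_cons] at hl
    rw [wedge_cons, extBoundary_vertex_mul]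
    refine sub_mem (wedge_mem_chainSpan ⟨by simpa using h, hl.2, fun v hv => by simp [hv]⟩) ?_
    rcases j with _ | j
    · have : l = [] := by simpa using h
      subst this
      simp
    · have hsub : {u | u ∈ l} ⊆ {u | u ∈ v :: l} := fun y hy => List.mem_cons_of_mem v hy
      have hv : v ∈ {u | u ∈ v :: l} := List.mem_cons_self
      have hc : ∀ y ∈ {u | u ∈ l}, y < v ∨ v < y := fun y hy => (hl.1 y hy).symm
      exact vertex_mul_mem_chainSpan hsub hv hc (ih hl.2 j (by simpa using h))

theorem extBoundary_mem {w : ExteriorAlgebra k (V →₀ k)} (hw : w ∈ chainSpan k X (j + 1)) :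
    extBoundary k w ∈ chainSpan k X j :=
  map_mem_of_mem_chainSpan _ _ (fun l hl => chainSpan_mono (fun v hv => hl.2.2 v hv) j
    (extBoundary_wedge_mem l hl.2.1 j hl.1)) hw

theorem extBoundary_eq_zero_of_mem {w : ExteriorAlgebra k (V →₀ k)} (hw : w ∈ chainSpan k X 0) :
    extBoundary k w = 0 := by
  rw [← Submodule.mem_bot k]
  refine map_mem_of_mem_chainSpan _ _ (fun l hl => ?_) hw
  rw [List.length_eq_zero_iff.1 hl.1]
  simp

/-- Together with `contractVertex_vertex_mul` this lets contraction extract `b` from `a + x ∧ b`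
when neither `a` nor `b` involves `x`; it replaces comparison of coefficients. -/
theorem contractVertex_eq_zero (hx : x ∉ X) {w : ExteriorAlgebra k (V →₀ k)}
    (hw : w ∈ chainSpan k X j) : contractVertex k x w = 0 := by
  rw [← Submodule.mem_bot k]
  refine map_mem_of_mem_chainSpan _ _ (fun l hl => ?_) hw
  have : ∀ l : List V, x ∉ l → contractVertex k x (wedge k l) = 0 := by
    intro l
    induction l with
    | nil => simp
    | cons v l ih =>
      intro h
      rw [List.mem_cons, not_or] at h
      rw [wedge_cons, contractVertex_mul k (Ne.symm h.1), ih h.2, mul_zero, neg_zero]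
  exact (Submodule.mem_bot k).2 (this l fun h => hx (hl.2.2 x h))

/-- The elements of `Y` comparable to `x` and different from it. -/
def link (x : V) (Y : Set V) : Set V := {y ∈ Y | y < x ∨ x < y}

theorem vertex_mul_mem_of_link {w : ExteriorAlgebra k (V →₀ k)}
    (hw : w ∈ chainSpan k (link x Y) j) : vertex k x * w ∈ chainSpan k (insert x Y) (j + 1) :=
  vertex_mul_mem_chainSpan (fun _ hy => Set.mem_insert_of_mem _ hy.1) (Set.mem_insert _ _)
    (fun _ hy => hy.2) hw

/-- A chain through `x` can be reordered, at the cost of a sign, so that `x` comes first; the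
remaining vertices then lie in the link. Allowing unsorted lists in `IsChainList` makes this
possible. -/
theorem exists_eq_add_vertex_mul {z : ExteriorAlgebra k (V →₀ k)}
    (hz : z ∈ chainSpan k (insert x Y) (j + 1)) :
    ∃ a ∈ chainSpan k Y (j + 1), ∃ b ∈ chainSpan k (link x Y) j, z = a + vertex k x * b := by
  classical
  have key : chainSpan k (insert x Y) (j + 1) ≤ chainSpan k Y (j + 1) ⊔
      (chainSpan k (link x Y) j).map (LinearMap.mulLeft k (vertex k x)) := by
    refine Submodule.span_le.2 ?_
    rintro _ ⟨l, hl, rfl⟩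
    by_cases hx : x ∈ l
    · have hperm := List.perm_cons_erase hx
      have hpw : (x :: l.erase x).Pairwise (fun a b => a < b ∨ b < a) :=
        hperm.pairwise hl.2.1 fun h => h.symm
      rw [List.pairwise_cons] at hpw
      have hmem : wedge k (l.erase x) ∈ chainSpan k (link x Y) j := by
        refine wedge_mem_chainSpan ⟨?_, hpw.2, fun v hv => ⟨?_, (hpw.1 v hv).symm⟩⟩
        · rw [List.length_erase_of_mem hx, hl.1, Nat.add_sub_cancel]
        · refine (hl.2.2 v (List.mem_of_mem_erase hv)).resolve_left ?_
          rintro rfl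
          exact (hpw.1 _ hv).elim (lt_irrefl _) (lt_irrefl _)
      refine Submodule.mem_sup_right ?_
      have h2 : wedge k (x :: l.erase x) ∈
          (chainSpan k (link x Y) j).map (LinearMap.mulLeft k (vertex k x)) :=
        ⟨_, hmem, by simp⟩
      rcases wedge_perm k hperm with h | h
      · rwa [h]
      · rw [h]; exact neg_mem h2
    · refine Submodule.mem_sup_left (wedge_mem_chainSpan ⟨hl.1, hl.2.1, fun v hv => ?_⟩)
      refine (hl.2.2 v hv).resolve_left ?_
      rintro rfl
      exact hx hv
  obtain ⟨a, ha, c, ⟨b, hb, rfl⟩, h⟩ := Submodule.mem_sup.1 (key hz)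
  exact ⟨a, ha, b, hb, h.symm⟩

theorem notMem_link : x ∉ link x Y := fun h => h.2.elim (lt_irrefl _) (lt_irrefl _)

theorem contractVertex_vertex_mul {w : ExteriorAlgebra k (V →₀ k)} (hx : x ∉ X)
    (hw : w ∈ chainSpan k X j) : contractVertex k x (vertex k x * w) = w := by
  rw [contractVertex_self_mul, contractVertex_eq_zero hx hw, mul_zero, sub_zero]

theorem contractVertex_vertex_mul_extBoundary {w : ExteriorAlgebra k (V →₀ k)} (hx : x ∉ X)
    (hw : w ∈ chainSpan k X j) :
    contractVertex k x (vertex k x * extBoundary k w) = extBoundary k w := by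
  rcases j with _ | j
  · rw [extBoundary_eq_zero_of_mem hw]; simp
  · exact contractVertex_vertex_mul hx (extBoundary_mem hw)

/-! ### Acyclicity: cones, and adding or deleting a vertex -/

variable (k) in
/-- The reduced homology of the order complex of `X` vanishes in dimensions less than `m - 1`. -/
def Acyclic (X : Set V) (m : ℕ) : Prop :=
  ∀ j < m, ∀ z ∈ chainSpan k X j, extBoundary k z = 0 →
    ∃ u ∈ chainSpan k X (j + 1), extBoundary k u = z

theorem Acyclic.mono {m' : ℕ} (h : Acyclic k X m) (hm : m' ≤ m) : Acyclic k X m' :=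
  fun j hj => h j (hj.trans_le hm)

theorem acyclic_of_cone {c : V} (hc : c ∈ X) (h : ∀ y ∈ X, y ≤ c ∨ c ≤ y) (m : ℕ) :
    Acyclic k X m := by
  intro j _ z hz hz0
  refine ⟨vertex k c * z, ?_, ?_⟩
  · rcases j with _ | j
    · exact vertex_mul_mem_chainSpan (Set.empty_subset X) hc (fun y hy => hy.elim)
        (by
          refine Submodule.span_mono (Set.image_mono ?_) hz
          intro l hl
          exact ⟨hl.1, hl.2.1, by rw [List.length_eq_zero_iff.1 hl.1]; simp⟩)
    · have hX : insert c (X \ {c}) = X := by simp [Set.insert_eq_of_mem hc]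
      rw [← hX] at hz
      obtain ⟨a, ha, b, hb, rfl⟩ := exists_eq_add_vertex_mul hz
      -- The simplices already containing the apex are killed by multiplication with it, so only
      -- `a`, supported away from `c`, remains.
      rw [mul_add, ← mul_assoc, vertex_mul_self, zero_mul, add_zero]
      refine vertex_mul_mem_chainSpan Set.sdiff_subset hc (fun y hy => ?_) ha
      exact (h y hy.1).imp (fun h => lt_of_le_of_ne h hy.2) (fun h => lt_of_le_of_ne h (Ne.symm hy.2))
  · rw [extBoundary_vertex_mul, hz0, mul_zero, sub_zero]

/-- For a cycle `a + x ∧ b`, the terms of its boundary involving `x` show that `b` is a cycle of the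
link. If `b = ∂c`, adding `∂(x ∧ c)` turns the given cycle into `a + c`, which lives in `Y`. Since
`b` has one vertex fewer, one degree less of acyclicity suffices for the link. -/
theorem Acyclic.insert_of_link (hx : x ∉ Y) (hY : Acyclic k Y (m + 1))
    (hl : Acyclic k (link x Y) m) : Acyclic k (insert x Y) (m + 1) := by
  intro j hj z hz hz0
  rcases j with _ | j
  · have hz' : z ∈ chainSpan k Y 0 := by
      refine Submodule.span_mono (Set.image_mono ?_) hz
      intro l hl
      exact ⟨hl.1, hl.2.1, by rw [List.length_eq_zero_iff.1 hl.1]; simp⟩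
    obtain ⟨u, hu, rfl⟩ := hY 0 hj z hz' hz0
    exact ⟨u, chainSpan_mono (Set.subset_insert _ _) _ hu, rfl⟩
  · obtain ⟨a, ha, b, hb, rfl⟩ := exists_eq_add_vertex_mul hz
    rw [map_add, extBoundary_vertex_mul] at hz0
    have hb0 : extBoundary k b = 0 := by
      have := congrArg (contractVertex k x) hz0
      rwa [map_add, map_sub, contractVertex_eq_zero hx (extBoundary_mem ha),
        contractVertex_eq_zero notMem_link hb, contractVertex_vertex_mul_extBoundary notMem_link hb,
        map_zero, zero_sub, zero_add, neg_eq_zero] at this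
    obtain ⟨c, hc, rfl⟩ := hl j (by omega) b hb hb0
    have hc' : c ∈ chainSpan k Y (j + 1) := chainSpan_mono (fun _ h => h.1) _ hc
    rw [hb0, mul_zero, sub_zero, ← map_add] at hz0
    obtain ⟨u, hu, hu0⟩ := hY (j + 1) hj _ (add_mem ha hc') hz0
    refine ⟨u - vertex k x * c, sub_mem (chainSpan_mono (Set.subset_insert _ _) _ hu)
      (vertex_mul_mem_of_link hc), ?_⟩
    rw [map_sub, extBoundary_vertex_mul, hu0]
    abel

/-- A filling `a + x ∧ b` of a cycle of `Y` is pushed off `x`: since its boundary avoids `x`, `b` is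
a cycle of the link, and `b = ∂c` allows `x ∧ b` to be replaced by `c`. Here `b` has as many
vertices as the cycle being filled, so no degree is lost. -/
theorem Acyclic.of_insert (hx : x ∉ Y) (hX : Acyclic k (insert x Y) m)
    (hl : Acyclic k (link x Y) m) : Acyclic k Y m := by
  intro j hj z hz hz0
  obtain ⟨u, hu, rfl⟩ := hX j hj z (chainSpan_mono (Set.subset_insert _ _) _ hz) hz0
  obtain ⟨a, ha, b, hb, rfl⟩ := exists_eq_add_vertex_mul hu
  rw [map_add, extBoundary_vertex_mul] at hz
  have hb0 : extBoundary k b = 0 := by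
    have := contractVertex_eq_zero hx hz
    rwa [map_add, map_sub, contractVertex_eq_zero hx (extBoundary_mem ha),
      contractVertex_eq_zero notMem_link hb, contractVertex_vertex_mul_extBoundary notMem_link hb,
      zero_sub, zero_add, neg_eq_zero] at this
  obtain ⟨c, hc, rfl⟩ := hl j hj b hb hb0
  refine ⟨a + c, add_mem ha (chainSpan_mono (fun _ h => h.1) _ hc), ?_⟩
  rw [map_add, map_add, extBoundary_vertex_mul, hb0, mul_zero, sub_zero]

end Exterior

/-! ### Acyclicity of intervals and truncations -/

section Rank

variable {P : Type*} [PartialOrder P] [Finite P]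

/-- The height of an element of a finite poset, as a natural number. -/
def rk (F : P) : ℕ := (Order.height F).toNat

theorem height_eq_rk (F : P) : Order.height F = (rk F : ℕ∞) :=
  (ENat.natCast_toNat (by
    have := Fintype.ofFinite P
    exact ne_top_of_le_ne_top (ENat.natCast_ne_top (Fintype.card P))
      (Order.height_le fun p _ => by exact_mod_cast p.length_lt_card.le))).symm

theorem height_eq_coe {F : P} {i : ℕ} : Order.height F = (i : ℕ∞) ↔ rk F = i := by
  rw [height_eq_rk, Nat.cast_inj]

theorem rk_strictMono : StrictMono (rk : P → ℕ) := by
  intro a b h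
  have := Order.height_add_one_le h
  rw [height_eq_rk, height_eq_rk] at this
  have : rk a + 1 ≤ rk b := by exact_mod_cast this
  omega

variable (P) in
/-- Every nontrivial interval `[H, G]` carries an order preserving, decreasing idempotent map which
moves `G`, moves elements down by at most one step, and whose fixed points are downward closed. In
the dual of a lattice of flats, joining with an atom provides such a map. -/
def HasRetractions : Prop :=
  ∀ H G : P, H < G → ∃ f : P → P, Monotone f ∧ f G ≠ G ∧
    (∀ y, H ≤ y → y ≤ G → H ≤ f y ∧ f (f y) = f y ∧ (f y = y ∨ f y ⋖ y)) ∧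
    ∀ x y, H ≤ x → x ≤ y → y ≤ G → f y = y → f x = x

variable {k : Type*} [Field k]

/-- The fixed points of `f` form a cone with apex `f G`. The other elements are attached in order of
decreasing rank. When `a` is attached, its link consists of the fixed points below `a`, all of them
below `f a`, and of everything in `(a, G)`. -/
theorem acyclic_Ioo (hcov : ∀ a b : P, a ⋖ b → rk b = rk a + 1) (hr : HasRetractions P) (G : P) :
    ∀ (m : ℕ) (H : P), H < G → rk G = rk H + m + 1 → Acyclic k (Set.Ioo H G) m := by
  classical
  intro m
  induction m with
  | zero => exact fun _ _ _ j hj => absurd hj (Nat.not_lt_zero j)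
  | succ m ih =>
    intro H hHG hrk
    obtain ⟨f, hmono, hfG, hf, hlow⟩ := hr H G hHG
    have main : ∀ T : Finset P, (∀ y ∈ T, y ∈ Set.Ioo H G ∧ f y ≠ y) →
        (∀ y ∈ T, ∀ x, y < x → x < G → x ∈ T) →
        Acyclic k ({y ∈ Set.Ioo H G | f y = y} ∪ (T : Set P)) (m + 1) := by
      intro T
      -- The rank is dualised so that the last element attached has least rank in `T`.
      induction T using Finset.induction_on_max_value (fun y : P => OrderDual.toDual (rk y)) with
      | empty =>
        intro _ _
        obtain ⟨h1, h2, h3⟩ := hf G hHG.le le_rfl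
        have h4 := h3.resolve_left hfG
        have h5 := hcov _ _ h4
        -- `G` covers `f G`, whereas the ranks of `G` and `H` differ by at least two, so `f G` lies
        -- in the open interval.
        have h6 : H < f G := lt_of_le_of_ne h1 (by intro h; rw [← h] at h5; omega)
        refine acyclic_of_cone (c := f G) (Or.inl ⟨⟨h6, h4.lt⟩, h2⟩) (fun y hy => Or.inl ?_) _
        rcases hy with hy | hy
        · rw [← hy.2]
          exact hmono hy.1.2.le
        · simp at hy
      | insert a s ha hmax ihs =>
        intro hT hup
        obtain ⟨⟨hHa, haG⟩, hfa⟩ := hT a (Finset.mem_insert_self a s)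
        have hs : ∀ y ∈ s, y ∈ Set.Ioo H G ∧ f y ≠ y :=
          fun y hy => hT y (Finset.mem_insert_of_mem hy)
        have hnlt : ∀ y ∈ s, ¬ y < a := by
          intro y hy hlt
          have h1 : rk a ≤ rk y := hmax y hy
          exact absurd (rk_strictMono hlt) (not_lt.2 h1)
        have hups : ∀ y ∈ s, ∀ x, y < x → x < G → x ∈ s := by
          intro y hy x hyx hxG
          refine (Finset.mem_insert.1 (hup y (Finset.mem_insert_of_mem hy) x hyx hxG)).resolve_left ?_
          rintro rfl
          exact hnlt y hy hyx
        have hset : ({y ∈ Set.Ioo H G | f y = y} ∪ ((insert a s : Finset P) : Set P)) =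
            insert a ({y ∈ Set.Ioo H G | f y = y} ∪ (s : Set P)) := by
          rw [Finset.coe_insert, Set.union_insert]
        rw [hset]
        obtain ⟨h1, h2, h3⟩ := hf a hHa.le haG.le
        have h4 := h3.resolve_left hfa
        refine (ihs hs hups).insert_of_link ?_ ?_
        · rintro (h | h)
          · exact hfa h.2
          · exact ha h
        -- If `f a = H`, no fixed point of the open interval lies below `a`, and the link is `(a,
        -- G)`, shorter by one rank. Otherwise `f a` belongs to the link and is comparable to all of
        -- it, so the link is a cone.
        · by_cases hH : f a = H
          · have hlink : link a ({y ∈ Set.Ioo H G | f y = y} ∪ (s : Set P)) = Set.Ioo a G := by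
              ext y
              constructor
              · rintro ⟨hy, hlt | hlt⟩
                · rcases hy with hy | hy
                  · have := hmono hlt.le
                    rw [hy.2, hH] at this
                    exact absurd hy.1.1 (not_lt_of_ge this)
                  · exact absurd hlt (hnlt y hy)
                · rcases hy with hy | hy
                  · exact ⟨hlt, hy.1.2⟩
                  · exact ⟨hlt, (hs y hy).1.2⟩
              · rintro ⟨hay, hyG⟩
                refine ⟨Or.inr ?_, Or.inr hay⟩
                refine (Finset.mem_insert.1 (hup a (Finset.mem_insert_self a s) y hay
                  hyG)).resolve_left ?_
                rintro rfl
                exact lt_irrefl _ hay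
            rw [hlink]
            refine ih a haG ?_
            have := hcov _ _ h4
            rw [hH] at this
            omega
          · have h6 : H < f a := lt_of_le_of_ne h1 (Ne.symm hH)
            have hc : f a ∈ link a ({y ∈ Set.Ioo H G | f y = y} ∪ (s : Set P)) :=
              ⟨Or.inl ⟨⟨h6, h4.lt.trans haG⟩, h2⟩, Or.inl h4.lt⟩
            refine acyclic_of_cone hc ?_ _
            rintro y ⟨hy, hlt | hlt⟩
            · rcases hy with hy | hy
              · left
                rw [← hy.2]
                exact hmono hlt.le
              · exact absurd hlt (hnlt y hy)
            · exact Or.inr (h4.lt.trans hlt).le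
    have hfin : ({y ∈ Set.Ioo H G | f y ≠ y}).Finite := Set.toFinite _
    have := main hfin.toFinset (by simp) (by
      intro y hy x hyx hxG
      rw [Set.Finite.mem_toFinset] at hy ⊢
      exact ⟨⟨hy.1.1.trans hyx, hxG⟩, fun h => hy.2 (hlow y x hy.1.1.le hyx.le hxG.le h)⟩)
    rw [Set.Finite.coe_toFinset] at this
    convert this using 1
    ext y
    simp only [Set.mem_union, Set.mem_ofPred_eq]
    tauto

variable [OrderBot P]

theorem rk_bot : rk (⊥ : P) = 0 := by
  rw [← height_eq_coe]; simp

/-- The elements of positive rank at most `i` below `G`. -/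
def truncation (G : P) (i : ℕ) : Set P := {y | ⊥ < y ∧ y ≤ G ∧ rk y ≤ i}

/-- The half-open interval `(⊥, G]` is a cone with apex `G`. The elements of rank above `i` are
deleted in order of decreasing rank; at its deletion, `a` has link `(⊥, a)`, to which `acyclic_Ioo`
applies. -/
theorem acyclic_truncation (hcov : ∀ a b : P, a ⋖ b → rk b = rk a + 1) (hr : HasRetractions P)
    {G : P} (hG : ⊥ < G) (i : ℕ) : Acyclic k (truncation G i) i := by
  classical
  have main : ∀ T : Finset P, (∀ y ∈ T, y ≤ G ∧ i < rk y) →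
      (∀ y ∈ T, ∀ x, x < y → i < rk x → x ∈ T) →
      Acyclic k (truncation G i ∪ (T : Set P)) i → Acyclic k (truncation G i) i := by
    intro T
    induction T using Finset.induction_on_max_value (fun y : P => rk y) with
    | empty => intro _ _ h; simpa using h
    | insert a s ha hmax ihs =>
      intro hT hdown hac
      have hs : ∀ y ∈ s, y ≤ G ∧ i < rk y := fun y hy => hT y (Finset.mem_insert_of_mem hy)
      have hi : i < rk a := (hT a (Finset.mem_insert_self a s)).2
      have haG : a ≤ G := (hT a (Finset.mem_insert_self a s)).1
      have ha0 : ⊥ < a := by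
        refine bot_lt_iff_ne_bot.2 ?_
        rintro rfl
        rw [rk_bot] at hi
        omega
      have hnlt : ∀ y ∈ s, ¬ a < y := fun y hy hlt =>
        absurd (rk_strictMono hlt) (not_lt.2 (hmax y hy))
      refine ihs hs ?_ ?_
      · intro y hy x hxy hx
        refine (Finset.mem_insert.1 (hdown y (Finset.mem_insert_of_mem hy) x hxy hx)).resolve_left ?_
        rintro rfl
        exact hnlt y hy hxy
      · rw [Finset.coe_insert, Set.union_insert] at hac
        refine hac.of_insert ?_ ?_
        · rintro (h | h)
          · exact absurd h.2.2 (not_le.2 hi)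
          · exact ha h
        · have hlink : link a (truncation G i ∪ (s : Set P)) = Set.Ioo ⊥ a := by
            ext y
            constructor
            · rintro ⟨hy, hlt | hlt⟩
              · refine ⟨?_, hlt⟩
                rcases hy with hy | hy
                · exact hy.1
                · refine bot_lt_iff_ne_bot.2 ?_
                  rintro rfl
                  have := (hs _ hy).2
                  rw [rk_bot] at this
                  omega
              · rcases hy with hy | hy
                · have h1 := rk_strictMono hlt
                  have h2 := hy.2.2
                  omega
                · exact absurd hlt (hnlt y hy)
            · rintro ⟨hy, hya⟩
              refine ⟨?_, Or.inl hya⟩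
              by_cases hyi : rk y ≤ i
              · exact Or.inl ⟨hy, hya.le.trans haG, hyi⟩
              · right
                refine (Finset.mem_insert.1 (hdown a (Finset.mem_insert_self a s) y hya
                  (not_le.1 hyi))).resolve_left hya.ne
          rw [hlink]
          -- The interval below `a` is acyclic up to `rk a - 1`, which is at least `i` because `rk a
          -- > i`.
          refine (acyclic_Ioo hcov hr a (rk a - 1) ⊥ ha0 ?_).mono (by omega)
          rw [rk_bot]
          omega
  have hfin : ({y : P | y ≤ G ∧ i < rk y}).Finite := Set.toFinite _
  refine main hfin.toFinset (by simp) ?_ ?_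
  · intro y hy x hxy hx
    rw [Set.Finite.mem_toFinset] at hy ⊢
    exact ⟨hxy.le.trans hy.1, hx⟩
  · have hmem : G ∈ truncation G i ∪ (hfin.toFinset : Set P) := by
      rw [Set.Finite.coe_toFinset]
      by_cases h : rk G ≤ i
      · exact Or.inl ⟨hG, le_rfl, h⟩
      · exact Or.inr ⟨le_rfl, not_le.1 h⟩
    refine acyclic_of_cone hmem (fun y hy => Or.inl ?_) _
    rw [Set.Finite.coe_toFinset] at hy
    rcases hy with hy | hy
    · exact hy.2.1
    · exact hy.1

end Rank

/-! ### Simplicial chains inside the exterior algebra -/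

section Embedding

variable {P : Type*} [PartialOrder P] [OrderBot P]
variable (k : Type*) [Field k]

/-- The embedding of the simplicial chains of `Δ(F)` into the exterior algebra. -/
def toExterior (F : P) (j : ℕ) : Chains k F j →ₗ[k] ExteriorAlgebra k (P →₀ k) :=
  Finsupp.linearCombination k fun s => wedge k (List.ofFn s.1)

theorem toExterior_single {F : P} {j : ℕ} (s : Simplex F j) (c : k) :
    toExterior k F j (Finsupp.single s c) = c • wedge k (List.ofFn s.1) :=
  Finsupp.linearCombination_single _ _ _

/-- In a linear extension of the dual order, decreasing chains become increasing sequences. Their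
wedges are then distinct members of the standard basis of an exterior power. -/
theorem toExterior_injective (F : P) (j : ℕ) : Function.Injective (toExterior k F j) := by
  let b : Module.Basis (LinearExtension Pᵒᵈ) k (P →₀ k) := Finsupp.basisSingleOne
  let emb : Simplex F j → (Fin j ↪o LinearExtension Pᵒᵈ) := fun s =>
    OrderEmbedding.ofStrictMono (fun a => toLinearExtension (OrderDual.toDual (s.1 a)))
      fun a a' h => lt_of_le_of_ne (toLinearExtension.monotone (s.2.1 h).le)
        fun e => (s.2.1 h).ne' e
  have hemb : Function.Injective emb := fun s t h =>
    Subtype.ext (funext fun a => congrArg (fun e : Fin j ↪o LinearExtension Pᵒᵈ => e a) h)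
  have hli := (exteriorPower.ιMulti_family_linearIndependent_ofBasis k j b).comp
    (fun s => Set.powersetCard.ofFinEmbEquiv (emb s))
    (Set.powersetCard.ofFinEmbEquiv.injective.comp hemb)
  have hli' := hli.map' (Submodule.subtype _) (Submodule.ker_subtype _)
  have heq : (Submodule.subtype (⋀[k]^j (P →₀ k)) ∘ (exteriorPower.ιMulti_family k j b ∘
      fun s => Set.powersetCard.ofFinEmbEquiv (emb s))) =
      fun s : Simplex F j => wedge k (List.ofFn s.1) := by
    funext s
    simp only [Function.comp_apply, exteriorPower.ιMulti_family, Submodule.subtype_apply,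
      exteriorPower.ιMulti_apply_coe, ExteriorAlgebra.ιMulti_apply, Equiv.symm_apply_apply,
      wedge, List.map_ofFn]
    congr 2
  rw [heq] at hli'
  exact hli'

theorem Simplex.isChainList {F : P} {j : ℕ} (s : Simplex F j) :
    IsChainList (Set.Ioo ⊥ F) j (List.ofFn s.1) := by
  refine ⟨by simp, ?_, ?_⟩
  · rw [List.pairwise_ofFn]
    exact fun a b h => Or.inr (s.2.1 h)
  · intro v hv
    obtain ⟨a, rfl⟩ := (List.mem_ofFn' _ _).1 hv
    exact s.2.2 a

theorem toExterior_mem {F : P} {j : ℕ} (z : Chains k F j) :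
    toExterior k F j z ∈ chainSpan k (Set.Ioo ⊥ F) j := by
  induction z using Finsupp.induction_linear with
  | zero => simp
  | add f g hf hg => rw [map_add]; exact add_mem hf hg
  | single s c =>
    rw [toExterior_single]
    exact Submodule.smul_mem _ _ (wedge_mem_chainSpan s.isChainList)

theorem extBoundary_wedge_ofFn {V : Type*} (j : ℕ) (v : Fin (j + 1) → V) :
    extBoundary k (wedge k (List.ofFn v)) =
      ∑ a : Fin (j + 1), (-1 : k) ^ (a : ℕ) • wedge k (List.ofFn (v ∘ a.succAbove)) := by
  induction j with
  | zero =>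
    rw [List.ofFn_succ, wedge_cons, extBoundary_vertex_mul]
    simp
  | succ j ih =>
    rw [List.ofFn_succ, wedge_cons, extBoundary_vertex_mul, ih, Fin.sum_univ_succ (n := j + 1),
      sub_eq_add_neg, Finset.mul_sum, ← Finset.sum_neg_distrib]
    refine congrArg₂ (· + ·) (by simp [Function.comp_def]) (Finset.sum_congr rfl fun a _ => ?_)
    rw [List.ofFn_succ (f := v ∘ a.succ.succAbove), wedge_cons, mul_smul_comm, Fin.val_succ,
      pow_succ, mul_neg, mul_one, neg_smul]
    simp [Function.comp_def]

theorem extBoundary_toExterior {F : P} {j : ℕ} (z : Chains k F (j + 1)) :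
    extBoundary k (toExterior k F (j + 1) z) = toExterior k F j (boundary k F j z) := by
  induction z using Finsupp.induction_linear with
  | zero => simp
  | add f g hf hg => simp only [map_add, hf, hg]
  | single s c =>
    rw [toExterior_single, map_smul, extBoundary_wedge_ofFn, boundary,
      Finsupp.linearCombination_single, map_smul, map_sum]
    simp only [toExterior_single]
    rfl

theorem extBoundary_toExterior_of_mem_cycles {F : P} :
    ∀ {j : ℕ} {z : Chains k F j}, z ∈ cycles k F j → extBoundary k (toExterior k F j z) = 0
  | 0, z, _ => extBoundary_eq_zero_of_mem (toExterior_mem k z)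
  | j + 1, z, hz => by
    have : boundary k F j z = 0 := hz
    rw [extBoundary_toExterior, this, map_zero]

theorem toExterior_empty (F : P) (z : Chains k F 0) :
    toExterior k F 0 z = algebraMap k _ (z default) := by
  rw [Finsupp.unique_single z, toExterior_single, Algebra.algebraMap_eq_smul_one]
  simp

variable [Finite P]

/-- Ranks drop strictly along a chain and stay positive. Hence a chain below `F` with `rk F - 1`
vertices meets every intermediate rank, and its first vertex is covered by `F`; this drives the
splittings by top vertex below. -/
theorem Simplex.lt_rk : ∀ (j : ℕ) {F : P} (_ : ⊥ < F) (_ : Simplex F j), j < rk F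
  | 0, F, hF, _ => by
    have := rk_strictMono hF
    omega
  | j + 1, F, hF, s => by
    have h1 := Simplex.lt_rk j (s.2.2 0).1 (s.tail rfl)
    have h2 := rk_strictMono (s.2.2 0).2
    omega

variable {k} in
theorem phi_eq_zero {F F' : P} {j : ℕ} (hF : rk F = j + 2) (h : ¬ F' ⋖ F)
    (z : Chains k F (j + 1)) : phi k F F' (j + 1) z = 0 := by
  induction z using Finsupp.induction_linear with
  | zero => simp
  | add f g hf hg => rw [map_add, hf, hg, add_zero]
  | single s c =>
    rw [phi, Finsupp.linearCombination_single, dif_neg, smul_zero]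
    rintro rfl
    have h1 := Simplex.lt_rk j (s.2.2 0).1 (s.tail rfl)
    refine h ⟨(s.2.2 0).2, fun x hx hx' => ?_⟩
    have h2 := rk_strictMono hx
    have h3 := rk_strictMono hx'
    omega

/-- The sum of `[F] ∧ a_F` over the elements `F` of rank `r`. -/
def levelSum (r j : ℕ) :
    ((F : Level P r) → Chains k F.1 j) →ₗ[k] ExteriorAlgebra k (P →₀ k) :=
  ∑ F : Level P r, (LinearMap.mulLeft k (vertex k F.1)) ∘ₗ (toExterior k F.1 j) ∘ₗ LinearMap.proj F

theorem levelSum_apply (r j : ℕ) (a : (F : Level P r) → Chains k F.1 j) :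
    levelSum k r j a = ∑ F : Level P r, vertex k F.1 * toExterior k F.1 j (a F) := by
  simp [levelSum]

theorem Level.rk_eq {r : ℕ} (F : Level P r) : rk F.1 = r := height_eq_coe.1 F.2

theorem contractVertex_toExterior {F x : P} {j : ℕ} (h : rk F ≤ rk x) (z : Chains k F j) :
    contractVertex k x (toExterior k F j z) = 0 :=
  contractVertex_eq_zero (fun hx => absurd (rk_strictMono hx.2) (not_lt.2 h)) (toExterior_mem k z)

theorem contractVertex_levelSum_of_lt {r j : ℕ} (a : (F : Level P r) → Chains k F.1 j) {x : P}
    (hx : r < rk x) : contractVertex k x (levelSum k r j a) = 0 := by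
  rw [levelSum_apply, map_sum]
  refine Finset.sum_eq_zero fun F _ => ?_
  have h := F.rk_eq
  rw [contractVertex_mul, contractVertex_toExterior k (by omega), mul_zero, neg_zero]
  intro e
  rw [e] at h
  omega

theorem contractVertex_levelSum {r j : ℕ} (a : (F : Level P r) → Chains k F.1 j) (F : Level P r) :
    contractVertex k F.1 (levelSum k r j a) = toExterior k F.1 j (a F) := by
  rw [levelSum_apply, map_sum, Finset.sum_eq_single F]
  · rw [contractVertex_self_mul, contractVertex_toExterior k le_rfl, mul_zero, sub_zero]
  · intro F' _ hne
    rw [contractVertex_mul, contractVertex_toExterior k (by rw [F.rk_eq, F'.rk_eq]), mul_zero,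
      neg_zero]
    exact fun e => hne (Subtype.ext e)
  · simp

theorem levelSum_injective (r j : ℕ) : Function.Injective (levelSum (P := P) k r j) := by
  intro a b h
  funext F
  apply toExterior_injective
  rw [← contractVertex_levelSum, h, contractVertex_levelSum]

theorem extBoundary_levelSum_succ {r j : ℕ} (a : (F : Level P r) → Chains k F.1 (j + 1)) :
    extBoundary k (levelSum k r (j + 1) a) =
      ∑ F, toExterior k F.1 (j + 1) (a F) - levelSum k r j (fun F => boundary k F.1 j (a F)) := by
  simp only [levelSum_apply, map_sum, extBoundary_vertex_mul, extBoundary_toExterior,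
    Finset.sum_sub_distrib]

/-- A chain of this length has its top vertex in rank exactly `j + 1`, so splitting off that vertex
is recorded by the maps `phi`. -/
theorem toExterior_eq_levelSum {F : P} {j : ℕ} (hF : rk F = j + 2) (z : Chains k F (j + 1)) :
    toExterior k F (j + 1) z = levelSum k (j + 1) j (fun F' => phi k F F'.1 (j + 1) z) := by
  classical
  induction z using Finsupp.induction_linear with
  | zero => simp [levelSum_apply]
  | add f g hf hg =>
    rw [map_add, hf, hg, ← map_add]
    congr 1
    funext F'
    simp
  | single s c =>
    have h1 := Simplex.lt_rk j (s.2.2 0).1 (s.tail rfl)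
    have h2 := rk_strictMono (s.2.2 0).2
    let F₀ : Level P (j + 1) := ⟨s.1 0, height_eq_coe.2 (by omega)⟩
    rw [levelSum_apply, Finset.sum_eq_single F₀]
    · rw [phi, Finsupp.linearCombination_single, dif_pos rfl, map_smul, toExterior_single,
        toExterior_single, List.ofFn_succ, wedge_cons, one_smul, mul_smul_comm]
      rfl
    · intro F' _ hne
      rw [phi, Finsupp.linearCombination_single, dif_neg, smul_zero, map_zero, mul_zero]
      exact fun e => hne (Subtype.ext e.symm)
    · simp

end Embedding

/-! ### Exactness of the complex of cycle spaces -/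

section Exactness

variable {P : Type*} [PartialOrder P]

/-- Sorting by insertion: pairwise comparability makes each new element split the sorted list into
the elements above it and those below it. -/
theorem exists_perm_pairwise_gt (l : List P) (hl : l.Pairwise (fun a b => a < b ∨ b < a)) :
    ∃ l' : List P, l.Perm l' ∧ l'.Pairwise (· > ·) := by
  classical
  induction l with
  | nil => exact ⟨[], List.Perm.nil, List.Pairwise.nil⟩
  | cons x l ih =>
    rw [List.pairwise_cons] at hl
    obtain ⟨l', hp, hs⟩ := ih hl.2
    refine ⟨l'.filter (fun y => x < y) ++ x :: l'.filter (fun y => ¬ x < y), ?_, ?_⟩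
    · refine (List.Perm.cons x (hp.trans ?_)).trans List.perm_middle.symm
      have := (List.filter_append_perm (fun y => decide (x < y)) l').symm
      simpa using this
    · have hcmp : ∀ y ∈ l', ¬ x < y → y < x := fun y hy h =>
        (hl.1 y (hp.mem_iff.2 hy)).resolve_left h
      refine List.pairwise_append.2 ⟨hs.filter _, List.pairwise_cons.2 ⟨?_, hs.filter _⟩, ?_⟩
      · intro y hy
        rw [List.mem_filter, decide_eq_true_iff] at hy
        exact hcmp y hy.1 hy.2
      · intro a ha b hb
        rw [List.mem_filter, decide_eq_true_iff] at ha
        rcases List.mem_cons.1 hb with rfl | hb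
        · exact ha.2
        · rw [List.mem_filter, decide_eq_true_iff] at hb
          exact (hcmp b hb.1 hb.2).trans ha.2

variable {k : Type*} [Field k]

theorem IsChainList.exists_strictAnti {X : Set P} {j : ℕ} {l : List P} (hl : IsChainList X j l) :
    ∃ v : Fin j → P, StrictAnti v ∧ (∀ a, v a ∈ X) ∧
      (wedge k l = wedge k (List.ofFn v) ∨ wedge k l = - wedge k (List.ofFn v)) := by
  obtain ⟨l', hp, hs⟩ := exists_perm_pairwise_gt l hl.2.1
  obtain rfl : l'.length = j := hp.length_eq.symm.trans hl.1
  refine ⟨l'.get, fun a b h => List.pairwise_iff_get.1 hs a b h,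
    fun a => hl.2.2 _ (hp.mem_iff.2 (List.get_mem _ _)), ?_⟩
  rw [List.ofFn_get]
  exact wedge_perm k hp

variable [OrderBot P] [Finite P]

/-- With `i + 1` vertices in ranks `1, …, i + 1`, every chain has its top vertex in rank `i + 1`.
The submodule `N` keeps track of the condition that this vertex lies below `G`. -/
theorem exists_levelSum_eq {G : P} {i : ℕ} {U : ExteriorAlgebra k (P →₀ k)}
    (hU : U ∈ chainSpan k (truncation G (i + 1)) (i + 1)) :
    ∃ u : (F : Level P (i + 1)) → Chains k F.1 i, (∀ F, ¬ F.1 ≤ G → u F = 0) ∧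
      levelSum k (i + 1) i u = U := by
  classical
  let N : Submodule k ((F : Level P (i + 1)) → Chains k F.1 i) :=
    Submodule.pi Set.univ fun F => if F.1 ≤ G then ⊤ else ⊥
  have key : chainSpan k (truncation G (i + 1)) (i + 1) ≤ N.map (levelSum k (i + 1) i) := by
    refine Submodule.span_le.2 ?_
    rintro _ ⟨l, hl, rfl⟩
    obtain ⟨v, hv, hvX, hw⟩ := hl.exists_strictAnti (k := k)
    let s : Simplex (v 0) i := ⟨fun a => v a.succ, hv.comp_strictMono Fin.strictMono_succ,
      fun a => ⟨(hvX _).1, hv (Fin.succ_pos a)⟩⟩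
    have h1 := Simplex.lt_rk i (hvX 0).1 s
    let F : Level P (i + 1) := ⟨v 0, height_eq_coe.2 (le_antisymm (hvX 0).2.2 h1)⟩
    have hmem : wedge k (List.ofFn v) ∈ N.map (levelSum k (i + 1) i) := by
      refine ⟨Pi.single F (Finsupp.single s 1), ?_, ?_⟩
      · rw [SetLike.mem_coe, Submodule.mem_pi]
        intro F' _
        by_cases h : F' = F
        · subst h
          rw [if_pos (hvX 0).2.1]
          exact Submodule.mem_top
        · rw [Pi.single_eq_of_ne h]
          exact Submodule.zero_mem _
      · rw [levelSum_apply, Finset.sum_eq_single F]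
        · rw [Pi.single_eq_same, toExterior_single, one_smul, List.ofFn_succ, wedge_cons]
        · intro F' _ h
          rw [Pi.single_eq_of_ne h, map_zero, mul_zero]
        · simp
    rcases hw with hw | hw <;> rw [hw]
    · exact hmem
    · exact neg_mem hmem
  obtain ⟨u, hu, rfl⟩ := key hU
  refine ⟨u, fun F hF => ?_, rfl⟩
  have := Submodule.mem_pi.1 hu F (Set.mem_univ _)
  rwa [if_neg hF, Submodule.mem_bot] at this

open Classical in
variable (k) in
/-- The component `Z_{i-1}(Δ(F)) → Z_{i-2}(Δ(F'))` of the differential, zero unless `F` covers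
`F'`. -/
def cycleComponent (F F' : P) (i : ℕ) : TopCycles k F (i + 1) →ₗ[k] TopCycles k F' i :=
  if h : F' ⋖ F then phiTop k h i else 0

theorem coe_cycleComponent_succ {i : ℕ} (F : Level P (i + 2)) (F' : P)
    (z : TopCycles k F.1 (i + 2)) :
    (cycleComponent k F.1 F' (i + 1) z).1 = phi k F.1 F' (i + 1) z.1 := by
  by_cases h : F' ⋖ F.1
  · rw [cycleComponent, dif_pos h]
    rfl
  · rw [cycleComponent, dif_neg h, phi_eq_zero F.rk_eq h]
    rfl

theorem sum_toExterior_eq_levelSum {i : ℕ} (y : (F : Level P (i + 2)) → Chains k F.1 (i + 1)) :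
    ∑ F, toExterior k F.1 (i + 1) (y F) =
      levelSum k (i + 1) i (fun F' => ∑ F : Level P (i + 2), phi k F.1 F'.1 (i + 1) (y F)) := by
  simp only [toExterior_eq_levelSum k (Level.rk_eq _), ← map_sum]
  congr 1
  funext F'
  rw [Finset.sum_apply]

theorem bot_covBy_of_level_one (F : Level P 1) : ⊥ ⋖ F.1 := by
  have h := F.rk_eq
  refine ⟨bot_lt_iff_ne_bot.2 fun e => ?_, fun x hx hx' => ?_⟩
  · rw [e, rk_bot] at h
    omega
  · have h1 := rk_strictMono hx
    have h2 := rk_strictMono hx'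
    omega

/-- This translates the kernel of the differential into one equation in the exterior algebra. The
lowest case is separate: the only target is `⊥`, and all cycle spaces involved are spanned by the
empty simplex. -/
theorem sum_toExterior_eq_zero_iff {i : ℕ}
    (y : (F : Level P (i + 1)) → TopCycles k F.1 (i + 1)) :
    ∑ F, toExterior k F.1 i (y F).1 = 0 ↔
      ∀ F' : Level P i, ∑ F : Level P (i + 1), cycleComponent k F.1 F'.1 i (y F) = 0 := by
  rcases i with _ | i
  · have key : ∀ (F : P) (z : Chains k F 0),
        toExterior k F 0 z = toExterior k ⊥ 0 (phi k F ⊥ 0 z) := by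
      intro F z
      rw [toExterior_empty, Finsupp.unique_single z, phi, Finsupp.linearCombination_single,
        map_smul, toExterior_single, Algebra.algebraMap_eq_smul_one]
      simp
    have hsum : ∑ F, toExterior k F.1 0 (y F).1 =
        toExterior k (⊥ : P) 0 (∑ F : Level P 1, cycleComponent k F.1 ⊥ 0 (y F)).1 := by
      rw [Submodule.coe_sum, map_sum]
      refine Finset.sum_congr rfl fun F _ => ?_
      rw [cycleComponent, dif_pos (bot_covBy_of_level_one F)]
      exact key F.1 _
    rw [hsum, map_eq_zero_iff _ (toExterior_injective k _ _), ZeroMemClass.coe_eq_zero]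
    constructor
    · rintro h ⟨F', hF'⟩
      obtain rfl : F' = ⊥ := by simpa using hF'
      exact h
    · exact fun h => h ⟨⊥, height_eq_coe.2 rk_bot⟩
  · have hsum : ∑ F, toExterior k F.1 (i + 1) (y F).1 = levelSum k (i + 1) i
        (fun F' => (∑ F : Level P (i + 2), cycleComponent k F.1 F'.1 (i + 1) (y F)).1) := by
      rw [sum_toExterior_eq_levelSum]
      congr 1
      funext F'
      rw [Submodule.coe_sum]
      exact Finset.sum_congr rfl fun F _ => (coe_cycleComponent_succ F F'.1 (y F)).symm
    rw [hsum, map_eq_zero_iff _ (levelSum_injective k _ _), funext_iff]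
    exact forall_congr' fun F' => ZeroMemClass.coe_eq_zero

theorem extBoundary_levelSum_of_cycles {i : ℕ}
    (y : (F : Level P (i + 1)) → TopCycles k F.1 (i + 1)) :
    extBoundary k (levelSum k (i + 1) i (fun F => (y F).1)) =
      ∑ F, toExterior k F.1 i (y F).1 := by
  rw [levelSum_apply, map_sum]
  refine Finset.sum_congr rfl fun F _ => ?_
  have hF : extBoundary k (toExterior k F.1 i (y F).1) = 0 :=
    extBoundary_toExterior_of_mem_cycles k (y F).2
  rw [extBoundary_vertex_mul]
  exact (congrArg (fun w => _ - vertex k F.1 * w) hF).trans (by rw [mul_zero, sub_zero])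

/-- The images of the `u_F` reassemble to `∑ u_F`, a sum of cycles; the boundary of that sum
vanishes, which is the kernel criterion. -/
theorem cycleComponent_comp {i : ℕ} (u : (F : Level P (i + 2)) → TopCycles k F.1 (i + 2))
    (F'' : Level P i) :
    ∑ F' : Level P (i + 1), cycleComponent k F'.1 F''.1 i
      (∑ F : Level P (i + 2), cycleComponent k F.1 F'.1 (i + 1) (u F)) = 0 := by
  refine (sum_toExterior_eq_zero_iff _).1 ?_ F''
  rw [← extBoundary_levelSum_of_cycles]
  have h : levelSum k (i + 1) i
      (fun F' => (∑ F : Level P (i + 2), cycleComponent k F.1 F'.1 (i + 1) (u F)).1) =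
      ∑ F, toExterior k F.1 (i + 1) (u F).1 := by
    rw [sum_toExterior_eq_levelSum]
    congr 1
    funext F'
    rw [Submodule.coe_sum]
    exact Finset.sum_congr rfl fun F _ => coe_cycleComponent_succ F F'.1 (u F)
  rw [h, map_sum]
  exact Finset.sum_eq_zero fun F _ => extBoundary_toExterior_of_mem_cycles k (u F).2

/-- Exactness of the complex of cycle spaces of a lower interval `[⊥, G]`. -/
theorem exists_cycles_lift (hcov : ∀ a b : P, a ⋖ b → rk b = rk a + 1) (hr : HasRetractions P)
    (G : P) {i : ℕ} (y : (F : Level P (i + 1)) → TopCycles k F.1 (i + 1))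
    (hyG : ∀ F, ¬ F.1 ≤ G → y F = 0)
    (hy : ∀ F' : Level P i, ∑ F : Level P (i + 1), cycleComponent k F.1 F'.1 i (y F) = 0) :
    ∃ u : (F : Level P (i + 2)) → TopCycles k F.1 (i + 2), (∀ F, ¬ F.1 ≤ G → u F = 0) ∧
      ∀ F' : Level P (i + 1), ∑ F : Level P (i + 2), cycleComponent k F.1 F'.1 (i + 1) (u F) =
        y F' := by
  by_cases hG : G = ⊥
  · refine ⟨0, fun _ _ => rfl, fun F' => ?_⟩
    rw [hyG F']
    · simp
    · intro h
      have := F'.rk_eq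
      subst hG
      rw [le_bot_iff.1 h, rk_bot] at this
      omega
  let y' : (F : Level P (i + 1)) → Chains k F.1 i := fun F => (y F).1
  have hW : levelSum k (i + 1) i y' ∈ chainSpan k (truncation G (i + 2)) (i + 1) := by
    rw [levelSum_apply]
    refine Submodule.sum_mem _ fun F _ => ?_
    have hF := F.rk_eq
    by_cases h : F.1 ≤ G
    · refine vertex_mul_mem_chainSpan (Y := Set.Ioo ⊥ F.1) ?_ ?_ (fun x hx => Or.inl hx.2)
        (toExterior_mem k _)
      · intro x hx
        have := rk_strictMono hx.2
        exact ⟨hx.1, hx.2.le.trans h, by omega⟩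
      · refine ⟨bot_lt_iff_ne_bot.2 fun e => ?_, h, by omega⟩
        rw [e, rk_bot] at hF
        omega
    · have : y' F = 0 := congrArg Subtype.val (hyG F h)
      rw [this, map_zero, mul_zero]
      exact zero_mem _
  have hW0 : extBoundary k (levelSum k (i + 1) i y') = 0 :=
     (extBoundary_levelSum_of_cycles y).trans ((sum_toExterior_eq_zero_iff y).2 hy)
  -- The cycle has `i + 1` vertices, so truncating at rank `i + 2` leaves just enough acyclicity to
  -- fill it and still forces the top vertices of the filling into rank `i + 2`.
  obtain ⟨U, hU, hUW⟩ := acyclic_truncation hcov hr (bot_lt_iff_ne_bot.2 hG) (i + 2) (i + 1)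
    (by omega) _ hW hW0
  obtain ⟨u, huG, rfl⟩ := exists_levelSum_eq hU
  rw [extBoundary_levelSum_succ, sum_toExterior_eq_levelSum] at hUW
  -- Contraction with `F` of rank `i + 2` kills both sums whose top vertices have rank `i + 1` and
  -- isolates the boundary of `u F`.
  have hcyc : ∀ F, boundary k F.1 i (u F) = 0 := by
    intro F
    have hF := F.rk_eq
    have := congrArg (contractVertex k F.1) hUW
    rw [map_sub, contractVertex_levelSum_of_lt k _ (by omega), contractVertex_levelSum,
      contractVertex_levelSum_of_lt k _ (by omega), zero_sub, neg_eq_zero] at this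
    exact toExterior_injective k _ _ (this.trans (map_zero _).symm)
  have hzero : (fun F : Level P (i + 2) => boundary k F.1 i (u F)) = 0 := funext hcyc
  rw [hzero, map_zero, sub_zero] at hUW
  have hfin := levelSum_injective k _ _ hUW
  refine ⟨fun F => ⟨u F, hcyc F⟩, fun F hF => Subtype.ext (huG F hF), fun F' => ?_⟩
  refine Subtype.ext ?_
  rw [Submodule.coe_sum]
  refine Eq.trans (Finset.sum_congr rfl fun F _ => ?_) (congrFun hfin F')
  exact coe_cycleComponent_succ F F'.1 ⟨u F, hcyc F⟩

end Exactness

/-! ### Coefficients of elements of the complex `𝒞(P)` -/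

section Coefficients

variable {P : Type*} [PartialOrder P] [OrderBot P] [Finite P] {σ : Type*}
variable {k : Type*} [Field k] {ℓ : P → σ →₀ ℕ}

theorem deg_le_of_coeff_ne_zero {F : P} {p : MvPolynomial σ k} (hp : p ∈ labelIdeal k ℓ F)
    {a : σ →₀ ℕ} (ha : MvPolynomial.coeff a p ≠ 0) : deg ℓ F ≤ a := by
  classical
  obtain ⟨q, rfl⟩ := Ideal.mem_span_singleton.1 hp
  by_contra h
  rw [MvPolynomial.coeff_monomial_mul', if_neg h] at ha
  exact ha rfl

theorem monomial_mem_labelIdeal {F : P} {a : σ →₀ ℕ} (h : deg ℓ F ≤ a) (c : k) :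
    MvPolynomial.monomial a c ∈ labelIdeal k ℓ F :=
  Ideal.mem_span_singleton.2 (MvPolynomial.monomial_dvd_monomial.2 ⟨Or.inr h, one_dvd _⟩)

variable (k ℓ)

/-- The coefficient of `x^a` of an element of the summand `Z ⊗ ⟨m_F⟩`, which is a cycle. -/
def coeffMap (F : P) (i : ℕ) (a : σ →₀ ℕ) : Summand k ℓ F i →ₗ[k] TopCycles k F i :=
  (TensorProduct.lid k _).toLinearMap ∘ₗ
    LinearMap.rTensor _ (MvPolynomial.lcoeff k a ∘ₗ
      (Submodule.subtype (labelIdeal k ℓ F)).restrictScalars k)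

open Classical in
/-- The monomial `x^a` as an element of `⟨m_F⟩`, or zero if it is not divisible by `m_F`. -/
def idealMonomial (F : P) (a : σ →₀ ℕ) : labelIdeal k ℓ F :=
  if h : deg ℓ F ≤ a then ⟨MvPolynomial.monomial a 1, monomial_mem_labelIdeal h 1⟩ else 0

/-- The map `z ↦ x^a ⊗ z`. -/
def monomialMap (F : P) (i : ℕ) (a : σ →₀ ℕ) : TopCycles k F i →ₗ[k] Summand k ℓ F i :=
  TensorProduct.mk k _ _ (idealMonomial k ℓ F a)

variable {k ℓ}

@[simp]
theorem coeffMap_tmul {F : P} {i : ℕ} (a : σ →₀ ℕ) (p : labelIdeal k ℓ F) (z : TopCycles k F i) :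
    coeffMap k ℓ F i a (p ⊗ₜ z) = MvPolynomial.coeff a (p : MvPolynomial σ k) • z := rfl

/-- This confines the strand of multidegree `a` to the `F` with `m_F ∣ x^a`. -/
theorem coeffMap_eq_zero {F : P} {i : ℕ} {a : σ →₀ ℕ} (h : ¬ deg ℓ F ≤ a)
    (t : Summand k ℓ F i) : coeffMap k ℓ F i a t = 0 := by
  induction t using TensorProduct.induction_on with
  | zero => exact map_zero _
  | add x y hx hy => rw [map_add, hx, hy, add_zero]
  | tmul p z =>
    rw [coeffMap_tmul, not_not.1 fun h' => h (deg_le_of_coeff_ne_zero p.2 h'), zero_smul]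

theorem coeffMap_monomialMap_self {F : P} {i : ℕ} {a : σ →₀ ℕ} (h : deg ℓ F ≤ a)
    (z : TopCycles k F i) : coeffMap k ℓ F i a (monomialMap k ℓ F i a z) = z := by
  classical
  change coeffMap k ℓ F i a (idealMonomial k ℓ F a ⊗ₜ z) = z
  rw [coeffMap_tmul, idealMonomial, dif_pos h, MvPolynomial.coeff_monomial, if_pos rfl, one_smul]

theorem coeffMap_monomialMap_of_ne {F : P} {i : ℕ} {a b : σ →₀ ℕ} (h : a ≠ b)
    (z : TopCycles k F i) : coeffMap k ℓ F i b (monomialMap k ℓ F i a z) = 0 := by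
  classical
  change coeffMap k ℓ F i b (idealMonomial k ℓ F a ⊗ₜ z) = 0
  rw [coeffMap_tmul, idealMonomial]
  split_ifs
  · rw [MvPolynomial.coeff_monomial, if_neg h, zero_smul]
  · simp

theorem sum_idealMonomial {F : P} (p : labelIdeal k ℓ F) {s : Finset (σ →₀ ℕ)}
    (hs : (p : MvPolynomial σ k).support ⊆ s) :
    ∑ a ∈ s, MvPolynomial.coeff a (p : MvPolynomial σ k) • idealMonomial k ℓ F a = p := by
  classical
  apply Subtype.ext
  rw [Submodule.coe_sum]
  conv_rhs => rw [(p : MvPolynomial σ k).as_sum]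
  rw [← Finset.sum_subset hs]
  · refine Finset.sum_congr rfl fun a ha => ?_
    rw [idealMonomial, dif_pos (deg_le_of_coeff_ne_zero p.2 (MvPolynomial.mem_support_iff.1 ha))]
    change MvPolynomial.coeff a (p : MvPolynomial σ k) • MvPolynomial.monomial a (1 : k) = _
    rw [MvPolynomial.smul_monomial, smul_eq_mul, mul_one]
  · intro a _ ha
    rw [MvPolynomial.notMem_support_iff.1 ha, zero_smul]
    rfl

/-- All finite sets containing `s` are allowed, so that one set can serve for sums of tensors and
for all summands of a term at once. -/
theorem exists_sum_monomialMap {F : P} {i : ℕ} (t : Summand k ℓ F i) :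
    ∃ s : Finset (σ →₀ ℕ), ∀ s', s ⊆ s' →
      ∑ a ∈ s', monomialMap k ℓ F i a (coeffMap k ℓ F i a t) = t := by
  classical
  induction t using TensorProduct.induction_on with
  | zero => exact ⟨∅, fun s' _ => by simp⟩
  | add x y hx hy =>
    obtain ⟨s, hs⟩ := hx
    obtain ⟨s', hs'⟩ := hy
    refine ⟨s ∪ s', fun r hr => ?_⟩
    simp only [map_add, Finset.sum_add_distrib]
    rw [hs r (Finset.union_subset_left hr), hs' r (Finset.union_subset_right hr)]
  | tmul p z =>
    refine ⟨(p : MvPolynomial σ k).support, fun s hs => ?_⟩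
    conv_rhs => rw [← sum_idealMonomial p hs, TensorProduct.sum_tmul]
    refine Finset.sum_congr rfl fun a _ => ?_
    rw [coeffMap_tmul, TensorProduct.smul_tmul]
    rfl

theorem summand_ext {F : P} {i : ℕ} {t t' : Summand k ℓ F i}
    (h : ∀ a, coeffMap k ℓ F i a t = coeffMap k ℓ F i a t') : t = t' := by
  classical
  obtain ⟨s, hs⟩ := exists_sum_monomialMap t
  obtain ⟨s', hs'⟩ := exists_sum_monomialMap t'
  rw [← hs _ Finset.subset_union_left, ← hs' _ (Finset.subset_union_right (s₁ := s))]
  exact Finset.sum_congr rfl fun a _ => by rw [h]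

theorem exists_sum_monomialMap_term {i : ℕ} (t : Term k ℓ i) :
    ∃ s : Finset (σ →₀ ℕ), ∀ F : Level P i,
      ∑ a ∈ s, monomialMap k ℓ F.1 i a (coeffMap k ℓ F.1 i a (t F)) = t F := by
  classical
  choose s hs using fun F : Level P i => exists_sum_monomialMap (t F)
  exact ⟨Finset.univ.biUnion s, fun F => hs F _ (Finset.subset_biUnion_of_mem s (Finset.mem_univ F))⟩


theorem coeffMap_eq_zero_of_mem_span {F : P} {i : ℕ} {a b : σ →₀ ℕ} (hb : b ≠ a)
    {t : Summand k ℓ F i}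
    (ht : t ∈ Submodule.span k {t : Summand k ℓ F i | ∃ (p : labelIdeal k ℓ F)
        (z : TopCycles k F i), (∃ c : k, (p : MvPolynomial σ k) = MvPolynomial.monomial a c) ∧
          t = p ⊗ₜ[k] z}) : coeffMap k ℓ F i b t = 0 := by
  classical
  induction ht using Submodule.span_induction with
  | mem x hx =>
    obtain ⟨p, z, ⟨c, hc⟩, rfl⟩ := hx
    rw [coeffMap_tmul, hc, MvPolynomial.coeff_monomial, if_neg hb.symm, zero_smul]
  | zero => exact map_zero _
  | add x y _ _ hx hy => rw [map_add, hx, hy, add_zero]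
  | smul c x _ hx => rw [map_smul, hx, smul_zero]

theorem monomialMap_mem_span {F : P} {i : ℕ} (a : σ →₀ ℕ) (z : TopCycles k F i) :
    monomialMap k ℓ F i a z ∈ Submodule.span k {t : Summand k ℓ F i | ∃ (p : labelIdeal k ℓ F)
        (z : TopCycles k F i), (∃ c : k, (p : MvPolynomial σ k) = MvPolynomial.monomial a c) ∧
          t = p ⊗ₜ[k] z} := by
  refine Submodule.subset_span ⟨idealMonomial k ℓ F a, z, ?_, rfl⟩
  by_cases hd : deg ℓ F ≤ a
  · exact ⟨1, by rw [idealMonomial, dif_pos hd]⟩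
  · refine ⟨0, ?_⟩
    rw [idealMonomial, dif_neg hd, MvPolynomial.monomial_zero, Submodule.coe_zero]

/-- Describing homogeneity by vanishing coefficients lets the grading statements be checked
coefficient by coefficient. -/
theorem mem_gradedPiece {i : ℕ} {a : σ →₀ ℕ} {t : Term k ℓ i} :
    t ∈ gradedPiece k ℓ i a ↔ ∀ F : Level P i, ∀ b : σ →₀ ℕ, b ≠ a → coeffMap k ℓ F.1 i b (t F) = 0 := by
  classical
  rw [gradedPiece, Submodule.mem_pi]
  constructor
  · exact fun h F b hb => coeffMap_eq_zero_of_mem_span hb (h F (Set.mem_univ F))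
  · intro h F _
    obtain ⟨s, hs⟩ := exists_sum_monomialMap (t F)
    rw [← hs s subset_rfl]
    refine Submodule.sum_mem _ fun b _ => ?_
    by_cases hb : b = a
    · subst hb
      exact monomialMap_mem_span b _
    · rw [h F b hb, map_zero]
      exact zero_mem _

theorem coeffMap_diffComponent {F F' : P} {i : ℕ} (a : σ →₀ ℕ) (t : Summand k ℓ F (i + 1)) :
    coeffMap k ℓ F' i a (diffComponent k ℓ F F' i t) =
      cycleComponent k F F' i (coeffMap k ℓ F (i + 1) a t) := by
  by_cases h : F' ⋖ F
  · rw [diffComponent, dif_pos h, cycleComponent, dif_pos h]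
    induction t using TensorProduct.induction_on with
    | zero => simp only [map_zero]
    | add x y hx hy => simp only [map_add, hx, hy]
    | tmul p z =>
      rw [TensorProduct.AlgebraTensorModule.map_tmul, coeffMap_tmul, coeffMap_tmul, map_smul,
        Submodule.coe_inclusion]
  · rw [diffComponent, dif_neg h, cycleComponent, dif_neg h, LinearMap.zero_apply, map_zero,
      LinearMap.zero_apply]

theorem diff_apply {i : ℕ} (t : Term k ℓ (i + 1)) (F' : Level P i) :
    diff k ℓ i t F' = ∑ F : Level P (i + 1), diffComponent k ℓ F.1 F'.1 i (t F) := by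
  simp [diff]

theorem coeffMap_diff {i : ℕ} (a : σ →₀ ℕ) (t : Term k ℓ (i + 1)) (F' : Level P i) :
    coeffMap k ℓ F'.1 i a (diff k ℓ i t F') =
      ∑ F : Level P (i + 1), cycleComponent k F.1 F'.1 i (coeffMap k ℓ F.1 (i + 1) a (t F)) := by
  rw [diff_apply, map_sum]
  exact Finset.sum_congr rfl fun F _ => coeffMap_diffComponent a (t F)

end Coefficients

/-! ### The complex `𝒞(P)` is a graded complex of free modules -/

section Graded

variable {P : Type*} [PartialOrder P] [OrderBot P] [Finite P] {σ : Type*}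
variable (k : Type*) [Field k] (ℓ : P → σ →₀ ℕ)

theorem diff_mem_gradedPiece (i : ℕ) (a : σ →₀ ℕ) (t : Term k ℓ (i + 1))
    (ht : t ∈ gradedPiece k ℓ (i + 1) a) : diff k ℓ i t ∈ gradedPiece k ℓ i a := by
  rw [mem_gradedPiece] at ht ⊢
  intro F' b hb
  rw [coeffMap_diff]
  exact Finset.sum_eq_zero fun F _ => by rw [ht F b hb, map_zero]

theorem monomial_smul_mem_gradedPiece (i : ℕ) (a b : σ →₀ ℕ) (c : k) (t : Term k ℓ i)
    (ht : t ∈ gradedPiece k ℓ i a) :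
    MvPolynomial.monomial b c • t ∈ gradedPiece k ℓ i (b + a) := by
  rw [gradedPiece, Submodule.mem_pi] at ht ⊢
  intro F _
  rw [Pi.smul_apply]
  have h := ht F (Set.mem_univ F)
  generalize t F = x at h
  induction h using Submodule.span_induction with
  | mem x hx =>
    obtain ⟨p, z, ⟨e, he⟩, rfl⟩ := hx
    refine Submodule.subset_span ⟨MvPolynomial.monomial b c • p, z, ⟨c * e, ?_⟩, ?_⟩
    · rw [Submodule.coe_smul, he, smul_eq_mul, MvPolynomial.monomial_mul]
    · rw [TensorProduct.smul_tmul']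
  | zero => rw [smul_zero]; exact zero_mem _
  | add x y _ _ hx hy => rw [smul_add]; exact add_mem hx hy
  | smul r x _ hx => rw [smul_comm]; exact Submodule.smul_mem _ _ hx

open Classical in
theorem coeffMap_coeAddMonoidHom {i : ℕ} (x : DirectSum (σ →₀ ℕ) fun a => gradedPiece k ℓ i a)
    (F : Level P i) (a : σ →₀ ℕ) :
    coeffMap k ℓ F.1 i a (DirectSum.coeAddMonoidHom (gradedPiece k ℓ i) x F) =
      coeffMap k ℓ F.1 i a ((x a : Term k ℓ i) F) := by
  induction x using DirectSum.induction_on with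
  | zero => rw [map_zero]; rfl
  | of b y =>
    rw [DirectSum.coeAddMonoidHom_of]
    by_cases h : b = a
    · subst h
      rw [DirectSum.of_eq_same]
    · rw [DirectSum.of_eq_of_ne _ _ _ (Ne.symm h), mem_gradedPiece.1 y.2 F a (Ne.symm h)]
      exact (map_zero _).symm
  | add x y hx hy =>
    rw [map_add, Pi.add_apply, map_add, hx, hy, ← map_add]
    rfl

open Classical in
theorem gradedPiece_isInternal (i : ℕ) : DirectSum.IsInternal (gradedPiece k ℓ i) := by
  constructor
  · intro x y hxy
    refine DFinsupp.ext fun a => Subtype.ext (funext fun F => summand_ext fun b => ?_)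
    by_cases hb : b = a
    · subst hb
      rw [← coeffMap_coeAddMonoidHom, hxy, coeffMap_coeAddMonoidHom]
    · rw [mem_gradedPiece.1 (x a).2 F b hb, mem_gradedPiece.1 (y a).2 F b hb]
  · intro t
    obtain ⟨s, hs⟩ := exists_sum_monomialMap_term t
    refine ⟨∑ a ∈ s, DirectSum.of (fun a => gradedPiece k ℓ i a) a
      ⟨fun F => monomialMap k ℓ F.1 i a (coeffMap k ℓ F.1 i a (t F)),
        mem_gradedPiece.2 fun F b hb => coeffMap_monomialMap_of_ne hb.symm _⟩, ?_⟩
    rw [map_sum]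
    funext F
    rw [Finset.sum_apply]
    conv_rhs => rw [← hs F]
    refine Finset.sum_congr rfl fun a _ => ?_
    rw [DirectSum.coeAddMonoidHom_of]

theorem _root_.Submodule.exists_finBasis {K V : Type*} [Field K] [AddCommGroup V] [Module K V]
    [Module.Finite K V] (W : Submodule K V) : ∃ m : ℕ, Nonempty (Module.Basis (Fin m) K W) :=
  ⟨_, ⟨Module.finBasis K W⟩⟩

theorem exists_basis_topCycles (F : P) (i : ℕ) :
    ∃ m : ℕ, Nonempty (Module.Basis (Fin m) k (TopCycles k F i)) := by
  have : Finite (Simplex F (i - 1)) :=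
    inferInstanceAs (Finite {s : Fin (i - 1) → P // StrictAnti s ∧ ∀ a, ⊥ < s a ∧ s a < F})
  exact Submodule.exists_finBasis (V := Chains k F (i - 1)) (TopCycles k F i)

theorem exists_basis_labelIdeal (F : P) :
    ∃ b : Module.Basis Unit (MvPolynomial σ k) (labelIdeal k ℓ F),
      ∀ u, (b u : MvPolynomial σ k) = MvPolynomial.monomial (deg ℓ F) 1 := by
  have hm : MvPolynomial.monomial (deg ℓ F) (1 : k) ≠ 0 := by simp
  refine ⟨Ideal.basisSpanSingleton (Module.Basis.singleton Unit (MvPolynomial σ k)) hm,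
    fun u => ?_⟩
  refine (Ideal.basisSpanSingleton_apply _ hm u).trans ?_
  rw [Module.Basis.singleton_apply, mul_one]

/-- The ideal `⟨m_F⟩` is free on `m_F`, so the elements `m_F ⊗ z`, with `z` in a `k`-basis of the
cycle space, form a basis, of multidegree `deg ℓ F`. -/
theorem exists_homogeneous_basis (i : ℕ) :
    ∃ (r : ℕ) (e : Module.Basis (Fin r) (MvPolynomial σ k) (Term k ℓ i)) (δ : Fin r → σ →₀ ℕ),
      ∀ q, e q ∈ gradedPiece k ℓ i (δ q) := by
  classical
  choose b₁ hb₁ using exists_basis_labelIdeal k ℓ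
  choose m b₂ using fun F : P => exists_basis_topCycles k F i
  let b : (F : Level P i) → Module.Basis (Unit × Fin (m F.1))
      (MvPolynomial σ k) (Summand k ℓ F.1 i) := fun F =>
    (b₁ F.1).tensorProduct (b₂ F.1).some
  let eq := Fintype.equivFin (Σ F : Level P i, Unit × Fin (m F.1))
  refine ⟨_, (Pi.basis b).reindex eq, fun q => deg ℓ (eq.symm q).1.1, fun q => ?_⟩
  rw [Module.Basis.reindex_apply]
  change _ ∈ gradedPiece k ℓ i (deg ℓ (eq.symm q).1.1)
  generalize eq.symm q = p
  obtain ⟨F, u, j⟩ := p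
  rw [Pi.basis_apply, mem_gradedPiece]
  intro F' a ha
  by_cases h : F' = F
  · subst h
    rw [Pi.single_eq_same]
    simp only [b]
    rw [Module.Basis.tensorProduct_apply, coeffMap_tmul, hb₁, MvPolynomial.coeff_monomial,
      if_neg ha.symm, zero_smul]
  · rw [Pi.single_eq_of_ne h, map_zero]

end Graded

/-! ### Exactness, augmentation and minimality -/

theorem linearCombination_one_eq (k : Type*) [Field k] {α : Type*} [Unique α] (z : α →₀ k) :
    Finsupp.linearCombination k (fun _ => (1 : k)) z = z default := by
  conv_lhs => rw [Finsupp.unique_single z]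
  rw [Finsupp.linearCombination_single, smul_eq_mul, mul_one]

section Resolution

variable {P : Type*} [PartialOrder P] [OrderBot P] [Finite P] {σ : Type*}
variable (k : Type*) [Field k] (ℓ : P → σ →₀ ℕ)

theorem diff_diff (i : ℕ) (t : Term k ℓ (i + 2)) : diff k ℓ i (diff k ℓ (i + 1) t) = 0 := by
  funext F
  refine summand_ext fun a => ?_
  rw [coeffMap_diff, Pi.zero_apply, map_zero]
  simp only [coeffMap_diff]
  exact cycleComponent_comp (fun F => coeffMap k ℓ F.1 (i + 2) a (t F)) F

/-- Coefficient extraction commutes with the differential, so a cycle is lifted separately in each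
multidegree, where `hdeg` identifies the strand with the complex of an interval `[⊥, G]`. Only
finitely many multidegrees occur. -/
theorem diff_exact (hcov : ∀ a b : P, a ⋖ b → rk b = rk a + 1) (hr : HasRetractions P)
    (hdeg : ∀ a : σ →₀ ℕ, ∃ G : P, ∀ F, deg ℓ F ≤ a ↔ F ≤ G) (i : ℕ) :
    Function.Exact (diff k ℓ (i + 1)) (diff k ℓ i) := by
  intro t
  constructor
  · intro ht
    have hlift : ∀ a : σ →₀ ℕ, ∃ u : (F : Level P (i + 2)) → TopCycles k F.1 (i + 2),
        (∀ F, ¬ deg ℓ F.1 ≤ a → u F = 0) ∧ ∀ F' : Level P (i + 1),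
          ∑ F : Level P (i + 2), cycleComponent k F.1 F'.1 (i + 1) (u F) =
            coeffMap k ℓ F'.1 (i + 1) a (t F') := by
      intro a
      obtain ⟨G, hG⟩ := hdeg a
      obtain ⟨u, hu, hu'⟩ := exists_cycles_lift hcov hr G
        (fun F : Level P (i + 1) => coeffMap k ℓ F.1 (i + 1) a (t F))
        (fun F hF => coeffMap_eq_zero (fun h => hF ((hG F.1).1 h)) _)
        (fun F' => by rw [← coeffMap_diff, ht, Pi.zero_apply, map_zero])
      exact ⟨u, fun F hF => hu F fun h => hF ((hG F.1).2 h), hu'⟩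
    choose u hu hu' using hlift
    obtain ⟨s, hs⟩ := exists_sum_monomialMap_term t
    refine ⟨fun F => ∑ a ∈ s, monomialMap k ℓ F.1 (i + 2) a (u a F), ?_⟩
    funext F'
    refine summand_ext fun a => ?_
    rw [coeffMap_diff]
    by_cases ha : a ∈ s
    · rw [← hu' a F']
      refine Finset.sum_congr rfl fun F _ => congrArg _ ?_
      rw [map_sum, Finset.sum_eq_single a (fun b _ hb => coeffMap_monomialMap_of_ne hb _)
        (fun h => absurd ha h)]
      -- If `m_F` does not divide `x^a`, then `monomialMap` is zero and loses `u a F`; this is why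
      -- the lift was required to vanish there.
      by_cases hd : deg ℓ F.1 ≤ a
      · exact coeffMap_monomialMap_self hd _
      · rw [hu a F hd, map_zero, map_zero]
    · rw [← hs F', map_sum]
      have hne : ∀ b ∈ s, b ≠ a := fun b hb e => ha (e ▸ hb)
      rw [Finset.sum_eq_zero fun b hb => coeffMap_monomialMap_of_ne (hne b hb) _]
      refine Finset.sum_eq_zero fun F _ => ?_
      rw [map_sum, Finset.sum_eq_zero fun b hb => coeffMap_monomialMap_of_ne (hne b hb) _, map_zero]
  · rintro ⟨u, rfl⟩
    exact diff_diff k ℓ i u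

/-- The component `p ⊗ c ∅ ↦ c p` of the augmentation. -/
def augComponent (F : P) : Summand k ℓ F 0 →ₗ[MvPolynomial σ k] MvPolynomial σ k :=
  (TensorProduct.AlgebraTensorModule.rid k (MvPolynomial σ k) (MvPolynomial σ k)).toLinearMap.comp
    (TensorProduct.AlgebraTensorModule.map (Submodule.subtype (labelIdeal k ℓ F))
      ((Finsupp.linearCombination k (fun _ => (1 : k))).comp (Submodule.subtype (TopCycles k F 0))))

theorem augmentation_apply (t : Term k ℓ 0) :
    augmentation k ℓ t = ∑ F : Level P 0, augComponent k ℓ F.1 (t F) := by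
  simp [augmentation, augComponent]

theorem augComponent_tmul {F : P} (p : labelIdeal k ℓ F) (z : TopCycles k F 0) :
    augComponent k ℓ F (p ⊗ₜ z) =
      (show Chains k F 0 from z.1) default • (p : MvPolynomial σ k) := by
  rw [augComponent, LinearMap.comp_apply, TensorProduct.AlgebraTensorModule.map_tmul]
  refine (TensorProduct.AlgebraTensorModule.rid_tmul _ _ _).trans ?_
  exact congrArg (fun c : k => c • (p : MvPolynomial σ k)) (linearCombination_one_eq k (α := Simplex F 0) _)

theorem coeff_augComponent {F : P} (a : σ →₀ ℕ) (t : Summand k ℓ F 0) :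
    MvPolynomial.coeff a (augComponent k ℓ F t) =
      (show Chains k F 0 from (coeffMap k ℓ F 0 a t).1) default := by
  induction t using TensorProduct.induction_on with
  | zero => simp only [map_zero]; rfl
  | add x y hx hy => rw [map_add, MvPolynomial.coeff_add, hx, hy, map_add]; rfl
  | tmul p z =>
    rw [augComponent_tmul, coeffMap_tmul, MvPolynomial.coeff_smul, smul_eq_mul, mul_comm]
    rfl

/-- The unique element of rank zero. -/
def bottomLevel : Level P 0 := ⟨⊥, height_eq_coe.2 rk_bot⟩

theorem eq_bottomLevel (F : Level P 0) : F = bottomLevel :=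
  Subtype.ext (show F.1 = ⊥ by simpa using F.2)

theorem augmentation_eq (t : Term k ℓ 0) :
    augmentation k ℓ t = augComponent k ℓ (bottomLevel : Level P 0).1 (t bottomLevel) := by
  rw [augmentation_apply]
  exact Finset.sum_eq_single _ (fun F _ h => absurd (eq_bottomLevel F) h)
    (fun h => absurd (Finset.mem_univ _) h)

theorem deg_bot : deg ℓ (⊥ : P) = 0 := by
  classical
  rw [deg, Finset.filter_false_of_mem, Finset.sup_empty]
  · rfl
  · rintro A - ⟨h, h'⟩
    exact h.1 (le_bot_iff.1 h')

theorem augmentation_mem (a : σ →₀ ℕ) (t : Term k ℓ 0) (ht : t ∈ gradedPiece k ℓ 0 a) :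
    ∃ c : k, augmentation k ℓ t = MvPolynomial.monomial a c := by
  classical
  refine ⟨MvPolynomial.coeff a (augmentation k ℓ t), MvPolynomial.ext _ _ fun b => ?_⟩
  rw [MvPolynomial.coeff_monomial]
  split_ifs with h
  · rw [h]
  · rw [augmentation_eq, coeff_augComponent, mem_gradedPiece.1 ht _ _ (Ne.symm h)]
    rfl

theorem augmentation_bijective : Function.Bijective (augmentation (P := P) k ℓ) := by
  constructor
  · intro t t' h
    funext F
    rw [eq_bottomLevel F]
    refine summand_ext fun a => Subtype.ext ?_
    have := congrArg (MvPolynomial.coeff a) h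
    rw [augmentation_eq, augmentation_eq, coeff_augComponent, coeff_augComponent] at this
    have hext : ∀ z z' : Chains k (bottomLevel : Level P 0).1 0, z default = z' default → z = z' :=
      fun z z' h => Finsupp.ext fun s => by rw [Unique.eq_default s, h]
    exact hext _ _ this
  · intro p
    have hp : p ∈ labelIdeal k ℓ (bottomLevel : Level P 0).1 := by
      change p ∈ labelIdeal k ℓ (⊥ : P)
      rw [labelIdeal, deg_bot]
      simp
    classical
    let z : TopCycles k (bottomLevel : Level P 0).1 0 :=
      ⟨(Finsupp.single default 1 : Chains k _ 0), Submodule.mem_top⟩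
    refine ⟨Pi.single bottomLevel (⟨p, hp⟩ ⊗ₜ z), ?_⟩
    rw [augmentation_eq, Pi.single_eq_same, augComponent_tmul]
    refine (congrArg (fun c : k => c • p) (Finsupp.single_eq_same (b := (1 : k)))).trans ?_
    rw [one_smul]

/-! ### The image of the first differential in the polynomial ring -/

theorem augmentation_diff (t : Term k ℓ 1) :
    augmentation k ℓ (diff k ℓ 0 t) =
      ∑ F : Level P 1, augComponent k ℓ ⊥ (diffComponent k ℓ F.1 ⊥ 0 (t F)) := by
  rw [augmentation_eq, diff_apply, map_sum]
  rfl

theorem augComponent_diffComponent_tmul (F : Level P 1) (p : labelIdeal k ℓ F.1)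
    (z : TopCycles k F.1 1) :
    augComponent k ℓ ⊥ (diffComponent k ℓ F.1 ⊥ 0 (p ⊗ₜ z)) =
      (show Chains k F.1 0 from z.1) default • (p : MvPolynomial σ k) := by
  rw [diffComponent, dif_pos (bot_covBy_of_level_one F),
    TensorProduct.AlgebraTensorModule.map_tmul, augComponent_tmul, Submodule.coe_inclusion]
  have key : ∀ z : Chains k F.1 0,
      (show Chains k (⊥ : P) 0 from phi k F.1 ⊥ 0 z) default = z default := by
    intro z
    conv_lhs => rw [Finsupp.unique_single z]
    simp only [phi]
    rw [Finsupp.linearCombination_single, Finsupp.smul_single, smul_eq_mul, mul_one]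
    exact Finsupp.single_eq_same
  exact congrArg (fun c : k => c • (p : MvPolynomial σ k)) (key _)

theorem range_augmentation_diff :
    LinearMap.range ((augmentation k ℓ).comp (diff k ℓ 0)) =
      ⨆ F : Level P 1, labelIdeal k ℓ F.1 := by
  classical
  apply le_antisymm
  · rintro _ ⟨t, rfl⟩
    rw [LinearMap.comp_apply, augmentation_diff]
    refine Submodule.sum_mem _ fun F _ => Submodule.mem_iSup_of_mem F ?_
    induction t F using TensorProduct.induction_on with
    | zero => rw [map_zero, map_zero]; exact zero_mem _
    | add x y hx hy => rw [map_add, map_add]; exact add_mem hx hy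
    | tmul p z =>
      rw [augComponent_diffComponent_tmul]
      exact Submodule.smul_of_tower_mem _ _ p.2
  · refine iSup_le fun F p hp => ?_
    let z : TopCycles k F.1 1 := ⟨(Finsupp.single default 1 : Chains k _ 0), Submodule.mem_top⟩
    refine ⟨Pi.single F (⟨p, hp⟩ ⊗ₜ z), ?_⟩
    rw [LinearMap.comp_apply, augmentation_diff, Finset.sum_eq_single F]
    · rw [Pi.single_eq_same, augComponent_diffComponent_tmul]
      refine (congrArg (fun c : k => c • p) (Finsupp.single_eq_same (b := (1 : k)))).trans ?_
      rw [one_smul]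
    · intro F' _ h
      rw [Pi.single_eq_of_ne h, map_zero, map_zero]
    · exact fun h => absurd (Finset.mem_univ _) h

/-! ### Minimality -/

theorem exists_eq_X_mul {F F' : P} (hle : deg ℓ F' ≤ deg ℓ F) (hne : deg ℓ F' ≠ deg ℓ F)
    {p : MvPolynomial σ k} (hp : p ∈ labelIdeal k ℓ F) :
    ∃ s, ∃ r ∈ labelIdeal k ℓ F', p = MvPolynomial.X s * r := by
  classical
  -- Since `m_F'` properly divides `m_F`, some variable `x_s` divides the quotient and can be
  -- factored out inside `⟨m_F'⟩`.
  obtain ⟨s, hs⟩ : ∃ s, deg ℓ F' s < deg ℓ F s := by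
    by_contra! h
    exact hne (le_antisymm hle h)
  obtain ⟨q, rfl⟩ := Ideal.mem_span_singleton.1 hp
  refine ⟨s, MvPolynomial.monomial (deg ℓ F - Finsupp.single s 1) 1 * q,
    Ideal.mul_mem_right _ _ (monomial_mem_labelIdeal (fun i => ?_) 1), ?_⟩
  · rw [Finsupp.tsub_apply, Finsupp.single_apply]
    split_ifs with h
    · subst h
      omega
    · exact hle i
  · rw [← mul_assoc, MvPolynomial.X, MvPolynomial.monomial_mul, one_mul,
      add_tsub_cancel_of_le]
    rw [Finsupp.single_le_iff]
    omega

theorem diffComponent_tmul_mem {F F' : P} (h : F' ⋖ F) (hne : deg ℓ F' ≠ deg ℓ F) (i : ℕ)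
    (p : labelIdeal k ℓ F) (z : TopCycles k F (i + 1)) :
    diffComponent k ℓ F F' i (p ⊗ₜ z) ∈
      Ideal.span (Set.range (MvPolynomial.X : σ → MvPolynomial σ k)) •
        (⊤ : Submodule (MvPolynomial σ k) (Summand k ℓ F' i)) := by
  obtain ⟨s, r, hr, hpr⟩ := exists_eq_X_mul k ℓ (deg_mono ℓ h.le) hne p.2
  have e1 : Submodule.inclusion (labelIdeal_anti k ℓ h.le) p =
      (MvPolynomial.X s : MvPolynomial σ k) • (⟨r, hr⟩ : labelIdeal k ℓ F') := by
    apply Subtype.ext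
    rw [Submodule.coe_inclusion, Submodule.coe_smul, smul_eq_mul]
    exact hpr
  have e2 : diffComponent k ℓ F F' i (p ⊗ₜ z) =
      Submodule.inclusion (labelIdeal_anti k ℓ h.le) p ⊗ₜ phiTop k h i z := by
    rw [diffComponent, dif_pos h, TensorProduct.AlgebraTensorModule.map_tmul]
  have e3 : ((MvPolynomial.X s : MvPolynomial σ k) • (⟨r, hr⟩ : labelIdeal k ℓ F')) ⊗ₜ[k]
      phiTop k h i z = (MvPolynomial.X s : MvPolynomial σ k) •
        ((⟨r, hr⟩ : labelIdeal k ℓ F') ⊗ₜ[k] phiTop k h i z) := by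
    rw [TensorProduct.smul_tmul']
  rw [e2, e1, e3]
  exact Submodule.smul_mem_smul (Ideal.subset_span ⟨s, rfl⟩) Submodule.mem_top

theorem diffComponent_mem (hne : ∀ F' F : P, F' ⋖ F → deg ℓ F' ≠ deg ℓ F) (F F' : P) (i : ℕ)
    (t : Summand k ℓ F (i + 1)) :
    diffComponent k ℓ F F' i t ∈
      Ideal.span (Set.range (MvPolynomial.X : σ → MvPolynomial σ k)) •
        (⊤ : Submodule (MvPolynomial σ k) (Summand k ℓ F' i)) := by
  by_cases h : F' ⋖ F
  · induction t using TensorProduct.induction_on with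
    | zero => rw [map_zero]; exact zero_mem _
    | add x y hx hy => rw [map_add]; exact add_mem hx hy
    | tmul p z => exact diffComponent_tmul_mem k ℓ h (hne F' F h) i p z
  · rw [diffComponent, dif_neg h]
    exact zero_mem _

theorem mem_ideal_smul_top_pi {R ι : Type*} [CommRing R] [Finite ι] {N : ι → Type*}
    [∀ i, AddCommMonoid (N i)] [∀ i, Module R (N i)] (I : Ideal R) (x : (i : ι) → N i)
    (hx : ∀ i, x i ∈ I • (⊤ : Submodule R (N i))) :
    x ∈ I • (⊤ : Submodule R ((i : ι) → N i)) := by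
  classical
  have := Fintype.ofFinite ι
  rw [← Finset.univ_sum_single x]
  refine Submodule.sum_mem _ fun i _ => ?_
  have h := Submodule.mem_map_of_mem (f := LinearMap.single R N i) (hx i)
  rw [Submodule.map_smul''] at h
  exact Submodule.smul_mono le_rfl le_top h

/-- The complex `𝒞(P)` of a finite labelled poset is a minimal graded free resolution of the ideal
generated by the labels of its elements of rank one, provided that `P` is graded, has the
retractions of `HasRetractions`, every set `{F | m_F ∣ x^a}` is a principal lower set, and the labels
change along covering relations. -/
theorem isMinimalGradedFreeResolution (hcov : ∀ a b : P, a ⋖ b → rk b = rk a + 1)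
    (hr : HasRetractions P) (hdeg : ∀ a : σ →₀ ℕ, ∃ G : P, ∀ F, deg ℓ F ≤ a ↔ F ≤ G)
    (hne : ∀ F' F : P, F' ⋖ F → deg ℓ F' ≠ deg ℓ F) :
    IsMinimalGradedFreeResolution (⨆ F : Level P 1, labelIdeal k ℓ F.1) (Term k ℓ) (diff k ℓ)
      (augmentation k ℓ) (gradedPiece k ℓ) where
  isInternal := gradedPiece_isInternal k ℓ
  smul_mem := fun i a b c x hx => monomial_smul_mem_gradedPiece k ℓ i a b c x hx
  free := exists_homogeneous_basis k ℓ
  d_mem := diff_mem_gradedPiece k ℓ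
  ε_mem := augmentation_mem k ℓ
  exact := diff_exact k ℓ hcov hr hdeg
  bijective := augmentation_bijective k ℓ
  range_eq := range_augmentation_diff k ℓ
  minimal := by
    rintro i _ ⟨t, rfl⟩
    refine mem_ideal_smul_top_pi _ _ fun F' => ?_
    rw [diff_apply]
    exact Submodule.sum_mem _ fun F _ => diffComponent_mem k ℓ hne F.1 F'.1 i (t F)

end Resolution

/-- A function such as `ρ` is the height up to the constant `ρ ⊥`: strict monotonicity bounds the
height from above, and a lower cover of `x` gives the reverse bound. -/
theorem rk_eq_add_one_of_covBy {P : Type*} [PartialOrder P] [OrderBot P] [Finite P] {ρ : P → ℕ}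
    (hmono : StrictMono ρ) (hρ : ∀ a b : P, a ⋖ b → ρ b = ρ a + 1) (a b : P) (h : a ⋖ b) :
    rk b = rk a + 1 := by
  have key : ∀ x : P, rk x + ρ ⊥ = ρ x := by
    intro x
    induction x using WellFoundedLT.induction with
    | ind x ih =>
      by_cases hx : x = ⊥
      · rw [hx, rk_bot, zero_add]
      · have hle : rk x ≤ ρ x - ρ ⊥ := by
          have : Order.height x ≤ ((ρ x - ρ ⊥ : ℕ) : ℕ∞) := by
            refine Order.height_le_coe_iff.2 fun y hy => ?_
            rw [height_eq_rk, Nat.cast_lt]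
            have h1 := ih y hy
            have h2 := hmono hy
            omega
          rw [height_eq_rk] at this
          exact_mod_cast this
        obtain ⟨y, -, hy⟩ := exists_le_covBy_of_lt (bot_lt_iff_ne_bot.2 hx)
        have h1 := ih y hy.lt
        have h2 := rk_strictMono hy.lt
        have h3 := hρ y x hy
        omega
  have h1 := key a
  have h2 := key b
  have h3 := hρ a b h
  omega

end PosetResolution

/-! ### Lattices of flats -/

namespace MatroidIdeal

section Flats

variable {σ : Type*} {M : Matroid σ}

theorem closure_subset_iff (hE : M.E = Set.univ) (K : Flats M) {X : Set σ} :
    M.closure X ⊆ K.1 ↔ X ⊆ K.1 :=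
  ⟨(M.subset_closure X (by rw [hE]; exact Set.subset_univ _)).trans,
    fun h => (M.closure_subset_closure h).trans K.2.closure.subset⟩

/-- The flat spanned by a flat and an element. -/
def join (p : σ) (F : Flats M) : Flats M := ⟨M.closure (insert p F.1), M.isFlat_closure _⟩

theorem le_join (hE : M.E = Set.univ) (p : σ) (F : Flats M) : F ≤ join p F :=
  show F.1 ⊆ M.closure (insert p F.1) from
    (Set.subset_insert p F.1).trans (M.subset_closure _ (by rw [hE]; exact Set.subset_univ _))

theorem mem_join (hE : M.E = Set.univ) (p : σ) (F : Flats M) : p ∈ (join p F).1 :=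
  M.subset_closure _ (by rw [hE]; exact Set.subset_univ _) (Set.mem_insert p F.1)

theorem join_le {p : σ} {F K : Flats M} (hF : F ≤ K) (hp : p ∈ K.1) : join p F ≤ K :=
  (M.closure_subset_closure (Set.insert_subset hp hF)).trans K.2.closure.subset

theorem join_eq_self (hE : M.E = Set.univ) {p : σ} {F : Flats M} : join p F = F ↔ p ∈ F.1 :=
  ⟨fun h => h ▸ mem_join hE p F, fun h => le_antisymm (join_le le_rfl h) (le_join hE p F)⟩

theorem join_mono (p : σ) : Monotone (join p : Flats M → Flats M) := fun _ _ h =>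
  M.closure_subset_closure (Set.insert_subset_insert h)

theorem mem_join_exchange {p q : σ} {F : Flats M} (hq : q ∈ (join p F).1) (hqF : q ∉ F.1) :
    p ∈ (join q F).1 := by
  rw [← F.2.closure] at hqF
  exact (M.closure_exchange ⟨hq, hqF⟩).1

/-- A flat above `F` and inside the join contains some `q ∉ F`; exchange puts `p` in the join of `F`
with `q`, so that flat already contains the whole join. -/
theorem covBy_join (hE : M.E = Set.univ) {p : σ} {F : Flats M} (hp : p ∉ F.1) :
    F ⋖ join p F := by
  refine ⟨lt_of_le_of_ne (le_join hE p F) fun h => hp ((join_eq_self hE).1 h.symm), ?_⟩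
  intro K hFK hK
  obtain ⟨q, hqK, hqF⟩ := Set.exists_of_ssubset (show F.1 ⊂ K.1 from hFK)
  have hp' : p ∈ K.1 := join_le hFK.le hqK (mem_join_exchange (hK.le hqK) hqF)
  exact absurd (join_le hFK.le hp') (not_le_of_gt hK)

theorem exists_eq_join_of_covBy (hE : M.E = Set.univ) {F K : Flats M} (h : F ⋖ K) :
    ∃ p ∉ F.1, K = join p F := by
  obtain ⟨p, hpK, hpF⟩ := Set.exists_of_ssubset (show F.1 ⊂ K.1 from h.lt)
  refine ⟨p, hpF, ?_⟩
  by_contra hne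
  exact h.2 (covBy_join hE hpF).lt (lt_of_le_of_ne (join_le h.le hpK) (Ne.symm hne))

/-- In the dual order `H < G` means that the flat `H` strictly contains `G`. Joining with some `p ∈
H \ G` works: its fixed points are the flats containing `p`, a family closed under enlarging the
flat. -/
theorem hasRetractions (hE : M.E = Set.univ) : PosetResolution.HasRetractions (Flats M)ᵒᵈ := by
  intro H G hHG
  obtain ⟨p, hpH, hpG⟩ := Set.exists_of_ssubset
    (show (OrderDual.ofDual G).1 ⊂ (OrderDual.ofDual H).1 from hHG)
  refine ⟨fun y => OrderDual.toDual (join p (OrderDual.ofDual y)), fun a b h => join_mono p h,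
    fun h => hpG ((join_eq_self hE).1 h), fun y hHy _ => ⟨join_le hHy hpH, ?_, ?_⟩, ?_⟩
  · exact (join_eq_self hE).2 (mem_join hE p _)
  · by_cases hp : p ∈ (OrderDual.ofDual y).1
    · exact Or.inl ((join_eq_self hE).2 hp)
    · exact Or.inr (covBy_join hE hp).toDual
  · intro x y _ hxy _ hy
    exact (join_eq_self hE).2 (hxy ((join_eq_self hE).1 hy))

/-- Every flat is thus an intersection of hyperplanes. A flat maximal among those avoiding `i` is a
hyperplane: if a larger flat missed some `j`, exchange would show that joining with `j` still avoids
`i`, against maximality. -/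
theorem exists_isCoatom (hE : M.E = Set.univ) [Finite σ] {F : Flats M} {i : σ} (hi : i ∉ F.1) :
    ∃ H : Flats M, IsCoatom H ∧ F ≤ H ∧ i ∉ H.1 := by
  obtain ⟨H, hFH, hH⟩ := (Set.toFinite {K : Flats M | i ∉ K.1}).exists_le_maximal hi
  refine ⟨H, ⟨fun h => hH.prop ?_, fun L hL => ?_⟩, hFH, hH.prop⟩
  · rw [h]
    change i ∈ M.E
    rw [hE]
    exact Set.mem_univ i
  · have hiL : i ∈ L.1 := by
      by_contra h
      exact absurd (hH.le_of_ge h hL.le) (not_le_of_gt hL)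
    refine top_le_iff.1 fun j _ => ?_
    by_contra hj
    have hjH : j ∉ H.1 := fun h => hj (hL.le h)
    have hij : i ∉ (join j H).1 := fun h =>
      hj (join_le hL.le hiL (mem_join_exchange h hH.prop))
    exact hjH (hH.le_of_ge hij (le_join hE j H) (mem_join hE j H))

/-- The rank of a flat of a finite matroid. -/
def flatRank (F : Flats M) : ℕ := (M.eRk F.1).toNat

variable [Finite σ]

theorem coe_flatRank (F : Flats M) : (flatRank F : ℕ∞) = M.eRk F.1 :=
  ENat.natCast_toNat (ne_top_of_le_ne_top (Set.toFinite F.1).encard_lt_top.ne (M.eRk_le_encard _))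

theorem flatRank_join (hE : M.E = Set.univ) {p : σ} {F : Flats M} (hp : p ∉ F.1) :
    flatRank (join p F) = flatRank F + 1 := by
  have h := M.eRk_insert_eq_add_one (e := p) (X := F.1)
    ⟨by rw [hE]; exact Set.mem_univ p, by rwa [F.2.closure]⟩
  have h' : (flatRank (join p F) : ℕ∞) = flatRank F + 1 := by
    rw [coe_flatRank, coe_flatRank, ← h]
    exact M.eRk_closure_eq _
  exact_mod_cast h'

theorem flatRank_strictMono (hE : M.E = Set.univ) : StrictMono (flatRank : Flats M → ℕ) := by
  intro F K h
  obtain ⟨p, hpK, hpF⟩ := Set.exists_of_ssubset (show F.1 ⊂ K.1 from h)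
  have h1 := flatRank_join hE hpF
  have h2 : (flatRank (join p F) : ℕ∞) ≤ flatRank K := by
    rw [coe_flatRank, coe_flatRank]
    exact M.eRk_mono (join_le h.le hpK)
  have h3 : flatRank (join p F) ≤ flatRank K := by exact_mod_cast h2
  omega

theorem rk_covBy (hE : M.E = Set.univ) (a b : (Flats M)ᵒᵈ) (h : a ⋖ b) :
    PosetResolution.rk b = PosetResolution.rk a + 1 := by
  have hle : ∀ F : Flats M, flatRank F ≤ flatRank (⊤ : Flats M) := fun F =>
    (flatRank_strictMono hE).monotone le_top
  refine PosetResolution.rk_eq_add_one_of_covBy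
    -- The corank; `hle` ensures that the natural-number subtraction does not truncate.
    (ρ := fun F : (Flats M)ᵒᵈ => flatRank (⊤ : Flats M) - flatRank (OrderDual.ofDual F)) ?_ ?_ a b h
  · intro a b hab
    have h1 := flatRank_strictMono hE (show OrderDual.ofDual b < OrderDual.ofDual a from hab)
    have h2 := hle (OrderDual.ofDual a)
    change _ - _ < _ - _
    omega
  · intro a b hab
    obtain ⟨p, hp, he⟩ := exists_eq_join_of_covBy hE hab.ofDual
    have h1 := flatRank_join hE hp
    have h2 := hle (OrderDual.ofDual a)
    rw [← he] at h1
    change _ - _ = _ - _ + 1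
    omega

end Flats

/-! ### Labels of flats and the matroid ideal -/

section Labels

variable {σ : Type*} [Fintype σ] {M : Matroid σ}

theorem complExponent_le {F : Set σ} {a : σ →₀ ℕ} :
    complExponent F ≤ a ↔ {i | a i = 0} ⊆ F := by
  classical
  constructor
  · intro h i hi
    by_contra hiF
    have h1 := h i
    have h2 : a i = 0 := hi
    simp [complExponent, hiF, h2] at h1
  · intro h i
    by_cases hi : i ∈ F
    · simp [complExponent, hi]
    · have h2 : a i ≠ 0 := fun h0 => hi (h h0)
      simp only [complExponent, Finsupp.equivFunOnFinite_symm_apply_apply, hi, if_false]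
      omega

theorem setOf_complExponent_eq_zero (F : Set σ) : {i | complExponent F i = 0} = F := by
  classical
  ext i
  simp [complExponent]

theorem complExponent_le_complExponent {F K : Set σ} :
    complExponent F ≤ complExponent K ↔ K ⊆ F := by
  rw [complExponent_le, setOf_complExponent_eq_zero]

/-- The variable `x_i` divides the lcm exactly when some hyperplane containing `F` misses `i`, that
is, when `i ∉ F`. -/
theorem deg_flatLabel (hE : M.E = Set.univ) (F : (Flats M)ᵒᵈ) :
    PosetResolution.deg (flatLabel M) F = complExponent (OrderDual.ofDual F).1 := by
  classical
  apply le_antisymm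
  · refine Finset.sup_le fun A hA => ?_
    rw [Finset.mem_filter] at hA
    exact complExponent_le_complExponent.2 hA.2.2
  · refine complExponent_le.2 fun i hi => ?_
    by_contra hiF
    obtain ⟨H, hH, hFH, hiH⟩ := exists_isCoatom hE hiF
    have hle : flatLabel M (OrderDual.toDual H) ≤ PosetResolution.deg (flatLabel M) F := by
      unfold PosetResolution.deg
      refine Finset.le_sup ?_
      rw [Finset.mem_filter]
      exact ⟨@Finset.mem_univ _ (_) _, hH.dual, hFH⟩
    exact hiH (complExponent_le.1 hle hi)

theorem iSup_labelIdeal (k : Type*) [Field k] (hE : M.E = Set.univ) :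
    ⨆ F : PosetResolution.Level (Flats M)ᵒᵈ 1, PosetResolution.labelIdeal k (flatLabel M) F.1 =
      matroidIdeal k M := by
  apply le_antisymm
  · refine iSup_le fun F => ?_
    rw [PosetResolution.labelIdeal, deg_flatLabel hE]
    refine Ideal.span_mono (Set.singleton_subset_iff.2 ⟨_, (OrderDual.ofDual F.1).2, fun h => ?_, rfl⟩)
    have h0 : F.1 = ⊥ := Subtype.ext h
    have h1 := (PosetResolution.bot_covBy_of_level_one F).lt.ne
    exact h1 h0.symm
  · refine Ideal.span_le.2 ?_
    rintro _ ⟨F, hF, hne, rfl⟩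
    let K : (Flats M)ᵒᵈ := OrderDual.toDual ⟨F, hF⟩
    -- A proper flat lies in a hyperplane, so its monomial is a multiple of the label of that
    -- hyperplane.
    obtain ⟨A, hA, hAK⟩ := (eq_bot_or_exists_atom_le K).resolve_left
      fun h => hne (congrArg (fun K : (Flats M)ᵒᵈ => (OrderDual.ofDual K).1) h)
    have h1 := rk_covBy hE _ _ (bot_covBy_iff.2 hA)
    rw [PosetResolution.rk_bot] at h1
    refine Ideal.mem_iSup_of_mem ⟨A, PosetResolution.height_eq_coe.2 h1⟩ ?_
    refine PosetResolution.labelIdeal_anti k (flatLabel M) hAK ?_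
    rw [PosetResolution.labelIdeal, deg_flatLabel hE]
    exact Ideal.subset_span rfl

end Labels

end MatroidIdeal

end

theorem mainTheorem3 (n : ℕ) (k : Type*) [Field k] (M : Matroid (Fin n)) (hE : M.E = Set.univ) :
    PosetResolution.IsMinimalGradedFreeResolution
      (MatroidIdeal.matroidIdeal k M)
      (PosetResolution.Term (P := (MatroidIdeal.Flats M)ᵒᵈ) k (MatroidIdeal.flatLabel M))
      (PosetResolution.diff k (MatroidIdeal.flatLabel M))
      (PosetResolution.augmentation k (MatroidIdeal.flatLabel M))
      (PosetResolution.gradedPiece k (MatroidIdeal.flatLabel M)) := by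
  rw [← MatroidIdeal.iSup_labelIdeal k hE]
  refine PosetResolution.isMinimalGradedFreeResolution k (MatroidIdeal.flatLabel M)
    (MatroidIdeal.rk_covBy hE) (MatroidIdeal.hasRetractions hE) (fun a => ?_) (fun F' F h e => ?_)
  -- A flat contains the zero set of `a` exactly when it contains the closure of that set, which
  -- makes the closure the greatest element of `P` whose label divides `x^a`.
  · refine ⟨OrderDual.toDual ⟨M.closure {i | a i = 0}, M.isFlat_closure _⟩, fun F => ?_⟩
    rw [MatroidIdeal.deg_flatLabel hE, MatroidIdeal.complExponent_le]
    exact (MatroidIdeal.closure_subset_iff hE (OrderDual.ofDual F)).symm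
  · rw [MatroidIdeal.deg_flatLabel hE, MatroidIdeal.deg_flatLabel hE] at e
    exact h.lt.ne' (le_antisymm (MatroidIdeal.complExponent_le_complExponent.1 e.ge)
      (MatroidIdeal.complExponent_le_complExponent.1 e.le))
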